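/- Write $\mathbb S^3\subset\mathbb C^2$ for the unit sphere with its round metric $g_3$, $\mathbb S^2(1/2)\subset\mathbb C\times\mathbb R$ for the round sphere of radius $1/2$ with metric $g_2$, and $\pi:\mathbb S^3\to\mathbb S^2(1/2)$, $\pi(z,w)=(z\bar w,\tfrac12|z|^2-\tfrac12|w|^2)$, for the Hopf map. For an open interval $I$ and a smooth $f:I\to(0,\infty)$, the closed FLRW spacetime $I\times_f\mathbb S^3$ is $I\times\mathbb S^3$ with the Lorentzian metric $-dt^2+f(t)^2g_3$; its expanding (collapsing) region is where $f'(t)>0$ (where $f'(t)<0$). An immersed spacelike surface is marginally trapped if its mean curvature vector is everywhere null (lightlike and nonzero). **Theorem (existence of marginally trapped surfaces crossing expanding and collapsing regions).** Let $I=(-1.3,1.3)$ and $k>0$. There is $F_0>0$, depending only on $k$, such that for every $f_0\ge F_0$ the initial value problem $$f'(t)=\frac{t}{2(2-t^2)}\,f(t)+\frac{\sqrt{2-t^2}}{2}\,k,\qquad f(0)=f_0,$$ has a solution on $[-1.3,1.3]$, and every solution $f$ has the following properties. 1. $f$ is smooth on $I$, $f>0$ on $[-1.3,1.3]$, and $f'$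 takes both negative and positive values on $(-1,1)$. In particular $I\times_f\mathbb S^3$ is a closed FLRW spacetime. 2. There are a circle of geodesic curvature $k$ in $\mathbb S^2(1/2)$ with a smooth unit speed parametrization $c:\mathbb R\to\mathbb S^2(1/2)$, a smooth function $\sigma:\mathbb R\to\mathbb R$ with $\sigma'>0$, and a smooth curve $\beta_2:\mathbb R\to\mathbb S^3$ such that, with $\alpha_2=c\circ\sigma$: the curve $\alpha(s)=(\sin s,\alpha_2(s))$ in $I\times\mathbb S^2(1/2)$ is spacelike of unit speed for the metric $-dt^2+f(t)^2g_2$; $\beta_2$ is a horizontal lift of $\alpha_2$, i.e. $\pi\circ\beta_2=\alpha_2$ and $\dot\beta_2\perp i\beta_2$; and the Hopf lift of $\alpha$, $$\phi:\mathbb R\times\mathbb S^1\to I\times_f\mathbb S^3,\qquad \phi(s,e^{i\theta})=(\sin s,\;e^{i\theta}\beta_2(s)),$$ is a smooth spacelike immersion which is marginally trapped and meets both the expanding and the collapsing region. -/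

import Mathlib

open scoped Manifold ContDiff InnerProductSpace

noncomputable section

/-! ### Surfaces in semi-Riemannian manifolds

Everything is written in the preferred charts of Mathlib: `TangentSpace I x` is the model vector
space, a tangent vector at `x` being identified with its coordinates in the chart at `x`. -/

section SemiRiemannian

variable {E H M : Type*} [NormedAddCommGroup E] [NormedSpace ℝ E] [TopologicalSpace H]
  (J : ModelWithCorners ℝ E H) [TopologicalSpace M] [ChartedSpace H M]

/-- A field of bilinear forms on the tangent spaces of `M` (a metric tensor). -/
abbrev MetricField : Type _ := ∀ p : M, LinearMap.BilinForm ℝ (TangentSpace J p)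

variable {J}

/-- The coefficient `g(v, w)`, for constant coordinate vector fields `v`, `w`, at the point with
coordinates `y` in the chart at `p`: the pull-back of `g` under the inverse of that chart. -/
def coordMetric (g : MetricField (M := M) J) (p : M) (v w : E) (y : E) : ℝ :=
  g ((extChartAt J p).symm y)
    (mfderiv 𝓘(ℝ, E) J (extChartAt J p).symm y v)
    (mfderiv 𝓘(ℝ, E) J (extChartAt J p).symm y w)

/-- Christoffel symbols of the first kind of the Levi-Civita connection, in the chart at `p` and
at the point `p`: `g(∇_a b, c)` for constant coordinate vector fields `a`, `b`, `c`, given by the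
Koszul formula. -/
def christoffelFirst (g : MetricField (M := M) J) (p : M) (a b c : TangentSpace J p) : ℝ :=
  (fderiv ℝ (coordMetric g p b c) (extChartAt J p p) a
    + fderiv ℝ (coordMetric g p a c) (extChartAt J p p) b
    - fderiv ℝ (coordMetric g p a b) (extChartAt J p p) c) / 2

variable {F K S : Type*} [NormedAddCommGroup F] [NormedSpace ℝ F] [TopologicalSpace K]
  {I : ModelWithCorners ℝ F K} [TopologicalSpace S] [ChartedSpace K S]

/-- The second coordinate derivative `∂_u ∂_v φ` at `x`, in the charts at `x` and `φ x`. -/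
def coordSecondDeriv (I : ModelWithCorners ℝ F K) (J : ModelWithCorners ℝ E H)
    (φ : S → M) (x : S) (u v : TangentSpace I x) : TangentSpace J (φ x) :=
  (fderiv ℝ (fun y : F => fderiv ℝ (writtenInExtChartAt I J x φ) y (v : F))
    (extChartAt I x x) (u : F) : E)

/-- `g(∇_u (dφ V), w)`, where `∇` is the Levi-Civita connection of `g` (along `φ`) and `V` is the
vector field on `S` with constant coordinates `v` in the chart at `x`. If `w` is normal to `φ`, this
is `g(h(u, v), w)` with `h` the second fundamental form of `φ`. -/
def covariantSecondDeriv (g : MetricField (M := M) J) (I : ModelWithCorners ℝ F K) (φ : S → M)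
    (x : S) (u v : TangentSpace I x) (w : TangentSpace J (φ x)) : ℝ :=
  g (φ x) (coordSecondDeriv I J φ x u v) w
    + christoffelFirst g (φ x) (mfderiv I J φ x u) (mfderiv I J φ x v) w

/-- The tangent vector `w` is normal to `φ` at `x`. -/
def IsNormalTo (g : MetricField (M := M) J) (I : ModelWithCorners ℝ F K) (φ : S → M)
    (x : S) (w : TangentSpace J (φ x)) : Prop :=
  ∀ u : TangentSpace I x, g (φ x) w (mfderiv I J φ x u) = 0

/-- `φ` is a smooth spacelike immersion: the induced metric is positive definite. -/
def IsSpacelikeImmersion (g : MetricField (M := M) J) (I : ModelWithCorners ℝ F K)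
    (φ : S → M) : Prop :=
  ContMDiff I J ∞ φ ∧
    ∀ (x : S) (u : TangentSpace I x), u ≠ 0 →
      0 < g (φ x) (mfderiv I J φ x u) (mfderiv I J φ x u)

/-- `Hvec` is the mean curvature vector at `x` of the immersion `φ` of a surface: the normal vector
equal to one half of the trace of the second fundamental form, the trace being taken in
a basis of the tangent plane that is orthonormal for the induced metric. -/
def IsMeanCurvatureVector (g : MetricField (M := M) J) (I : ModelWithCorners ℝ F K) (φ : S → M)
    (x : S) (Hvec : TangentSpace J (φ x)) : Prop :=
  IsNormalTo g I φ x Hvec ∧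
    ∃ e : Module.Basis (Fin 2) ℝ (TangentSpace I x),
      (∀ i j, g (φ x) (mfderiv I J φ x (e i)) (mfderiv I J φ x (e j)) = if i = j then 1 else 0) ∧
      ∀ w : TangentSpace J (φ x), IsNormalTo g I φ x w →
        g (φ x) Hvec w = (∑ i, covariantSecondDeriv g I φ x (e i) (e i) w) / 2

/-- A (spacelike, immersed) surface is marginally trapped if its mean curvature vector is
everywhere null, i.e. nonzero and lightlike. -/
def IsMarginallyTrapped (g : MetricField (M := M) J) (I : ModelWithCorners ℝ F K)
    (φ : S → M) : Prop :=
  IsSpacelikeImmersion g I φ ∧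
    ∀ x : S, ∃ Hvec : TangentSpace J (φ x),
      IsMeanCurvatureVector g I φ x Hvec ∧ Hvec ≠ 0 ∧ g (φ x) Hvec Hvec = 0

end SemiRiemannian

/-! ### Closed FLRW spacetimes -/

/-- `ℂ²`. -/
abbrev C2 : Type := EuclideanSpace ℂ (Fin 2)

instance : Fact (Module.finrank ℝ C2 = 3 + 1) :=
  ⟨by rw [← Module.finrank_mul_finrank ℝ ℂ C2, Complex.finrank_real_complex,
        finrank_euclideanSpace_fin]⟩

/-- The unit sphere of `ℂ²`. -/
abbrev S3 : Type := Metric.sphere (0 : C2) 1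

/-- The manifold `I × S³`, for an open set `I` of the real line. -/
abbrev ClosedFLRW (I : TopologicalSpace.Opens ℝ) : Type := I × S3

/-- The model with corners of the manifold `I × S³`. -/
abbrev flrwModel : ModelWithCorners ℝ (ℝ × EuclideanSpace ℝ (Fin 3))
    (ModelProd ℝ (EuclideanSpace ℝ (Fin 3))) :=
  𝓘(ℝ, ℝ).prod (𝓡 3)

/-- The metric `-dt² + f(t)² g₃` of `I ×_f S³`, with `g₃` induced from `ℂ²`. -/
def flrwMetric (I : TopologicalSpace.Opens ℝ) (f : ℝ → ℝ) :
    MetricField (M := ClosedFLRW I) flrwModel := fun p =>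
  let dt : TangentSpace flrwModel p →ₗ[ℝ] ℝ :=
    (mfderiv flrwModel 𝓘(ℝ, ℝ) (fun q : ClosedFLRW I => (q.1 : ℝ)) p).toLinearMap
  let dq : TangentSpace flrwModel p →ₗ[ℝ] C2 :=
    (mfderiv flrwModel 𝓘(ℝ, C2) (fun q : ClosedFLRW I => (q.2 : C2)) p).toLinearMap
  (f p.1) ^ 2 • (innerₗ C2).compl₁₂ dq dq - (LinearMap.mul ℝ ℝ).compl₁₂ dt dt

/-- `f` is a warping function on `I`: smooth and positive there. -/
def IsWarpingFunction (I : TopologicalSpace.Opens ℝ) (f : ℝ → ℝ) : Prop :=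
  ContDiffOn ℝ ∞ f I ∧ ∀ t ∈ I, 0 < f t

/-! ### The Hopf map and Hopf lifts -/

/-- The Euclidean space `ℂ × ℝ`, which contains the sphere `S²(1/2)` of radius `1/2`. -/
abbrev CR : Type := WithLp 2 (ℂ × ℝ)

/-- The Hopf map `S³ → S²(1/2)`. -/
def hopfMap (p : S3) : CR :=
  WithLp.toLp 2 ((p : C2) 0 * (starRingEnd ℂ) ((p : C2) 1),
    ‖(p : C2) 0‖ ^ 2 / 2 - ‖(p : C2) 1‖ ^ 2 / 2)

/-- The action of the unit complex numbers on `S³` by scalar multiplication. -/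
def circleAction (z : Circle) (p : S3) : S3 :=
  ⟨(z : ℂ) • (p : C2), by
    rw [mem_sphere_zero_iff_norm, norm_smul, Circle.norm_coe, one_mul]
    exact norm_eq_of_mem_sphere p⟩

/-- `c` is a unit speed parametrization of a circle of `S²(1/2)` with geodesic curvature `k`:
`∇_{c'} c' = k n`, with `(c', n)` an orthonormal basis of the tangent plane along `c`. Here
`∇_{c'} c'` is the orthogonal projection of `c''` to the tangent plane of the sphere. -/
def IsCircleOfCurvature (k : ℝ) (c : ℝ → CR) : Prop :=
  ContDiff ℝ ∞ c ∧ (∀ u, c u ∈ Metric.sphere (0 : CR) (1 / 2)) ∧ (∀ u, ‖deriv c u‖ = 1) ∧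
    ∃ n : ℝ → CR, Continuous n ∧
      ∀ u, ‖n u‖ = 1 ∧ ⟪n u, c u⟫_ℝ = 0 ∧ ⟪n u, deriv c u⟫_ℝ = 0 ∧
        (ℝ ∙ c u)ᗮ.starProjection (deriv (deriv c) u) = k • n u

/-- The curve `s ↦ (t s, a s)` of `I ×_f S²(1/2)` is spacelike with unit speed for the metric
`-dt² + f(t)² g₂`. -/
def IsUnitSpacelikeCurve (f : ℝ → ℝ) (t : ℝ → ℝ) (a : ℝ → CR) : Prop :=
  ∀ s, -(deriv t s) ^ 2 + f (t s) ^ 2 * ‖deriv a s‖ ^ 2 = 1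

/-- `b` is a horizontal lift to `S³` of the curve `a` under the Hopf map: `b'` is
orthogonal to the vector `i b`, which spans the vertical space. -/
def IsHorizontalLift (a : ℝ → CR) (b : ℝ → S3) : Prop :=
  ContDiff ℝ ∞ (fun s => (b s : C2)) ∧ (∀ s, hopfMap (b s) = a s) ∧
    ∀ s, ⟪deriv (fun r => (b r : C2)) s, Complex.I • (b s : C2)⟫_ℝ = 0

/-- The surface `(s, e^{iθ}) ↦ (t s, e^{iθ} b s)` in `I × S³`: the Hopf lift of the curve
`s ↦ (t s, hopfMap (b s))`. -/
def hopfLift {I : TopologicalSpace.Opens ℝ} (t : ℝ → I) (b : ℝ → S3) :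
    ℝ × Circle → ClosedFLRW I :=
  fun x => (t x.1, circleAction x.2 (b x.1))

/-- The model with corners of the surface `ℝ × S¹`. -/
abbrev surfaceModel : ModelWithCorners ℝ (ℝ × EuclideanSpace ℝ (Fin 1))
    (ModelProd ℝ (EuclideanSpace ℝ (Fin 1))) :=
  𝓘(ℝ, ℝ).prod (𝓡 1)

/-! ### The warping function and the time coordinate -/

/-- The interval `(-1.3, 1.3)`. -/
def timeInterval : TopologicalSpace.Opens ℝ := ⟨Set.Ioo (-1.3) 1.3, isOpen_Ioo⟩

/-- `f` solves `f' = t f / (2 (2 - t²)) + (√(2 - t²) / 2) k` on `[-1.3, 1.3]`, with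
`f(0) = f₀`. -/
def IsWarpingSolution (k f₀ : ℝ) (f : ℝ → ℝ) : Prop :=
  f 0 = f₀ ∧ ∀ t ∈ Set.Icc (-1.3 : ℝ) 1.3,
    HasDerivWithinAt f (t / (2 * (2 - t ^ 2)) * f t + √(2 - t ^ 2) / 2 * k)
      (Set.Icc (-1.3) 1.3) t

/-- The time coordinate `t(s) = sin s`, as a map to `(-1.3, 1.3)`. -/
def sineTime (s : ℝ) : timeInterval :=
  ⟨Real.sin s, lt_of_lt_of_le (by norm_num) (Real.neg_one_le_sin s),
    lt_of_le_of_lt (Real.sin_le_one s) (by norm_num)⟩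

end

/-! Let `B` be a horizontal unit speed lift of the circle `c`, and put `F = f (sin s)`, `V = σ' s`.
Unit speed of `α` means `F² V² = 1 + cos² s`. Let `q` be the position in `S³` and `X` the velocity
of `B`, both rotated by `e^{iθ}`. The surface is tangent to `(cos s, V X)` and to the fibre
direction `(0, i q)`. Its normal plane has the orthonormal frame `N₁ = (0, i X / F)`, spacelike, and
`N₂ = (F V, cos s X / F)`, timelike.

Since the acceleration of `B` in `S³` is `k i B'`, the mean curvature vector always has
`N₁`-component `k F V² / 2`. It is null as soon as its `N₂`-coefficient is the same number, and this
is a first order linear equation for `f` along `t = sin s`. Because `2 - t² = 1 + cos² s = F² V²`,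
it is exactly the equation of the theorem (`mean_curvature_identity`). Hence `H = (k F V² / 2) (N₁ +
N₂)`, which is lightlike, and nonzero because `k > 0`; this is `isMarginallyTrapped_hopfLift`.

The remaining analysis is elementary. With the integrating factor `μ = (2 - t²)^(1/4)` one has `(μ
f)' = k μ³ / 2`, so a large `f₀` keeps `f` large on the whole interval. Then `f > 0`, and the term
`t f / (2 (2 - t²))` makes `f'` negative at `t = -0.9`, while `f'(0) > 0` for every `f₀`. As `sin s`
reaches both times, the surface meets both regions. The circle and its lift are explicit: a parallel
of `S²(1/2)` and a curve `(a e^{ipu}, d e^{iqu})` on a torus of `S³`.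

The chart-based definitions are evaluated through the embedding of `I × S³` in `ℝ × ℂ²`: Christoffel
symbols and second derivatives in charts combine into derivatives of the two components
(`covariantSecondDeriv_flrwMetric`). -/

/-! ### Second derivatives and the Koszul formula for a warped metric -/

section SecondDerivatives

variable {E F V : Type*} [NormedAddCommGroup E] [NormedSpace ℝ E] [NormedAddCommGroup F]
  [NormedSpace ℝ F] [NormedAddCommGroup V]

theorem ContDiffAt.differentiableAt_fderiv [NormedSpace ℝ V] {P : E → V} {x : E}
    (hP : ContDiffAt ℝ ∞ P x) : DifferentiableAt ℝ (fderiv ℝ P) x :=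
  (hP.fderiv_right (m := 1) (by norm_cast)).differentiableAt (by norm_num)

theorem fderiv_fderiv_apply [NormedSpace ℝ V] {P : E → V} {x : E} (hP : ContDiffAt ℝ ∞ P x)
    (a b : E) : fderiv ℝ (fun y => fderiv ℝ P y b) x a = fderiv ℝ (fderiv ℝ P) x a b := by
  rw [fderiv_clm_apply hP.differentiableAt_fderiv (differentiableAt_const b)]
  simp

/-- Second order chain rule. Its Hessian term is what the Christoffel symbols supply, its other term
what the coordinate second derivative supplies. -/
theorem fderiv_fderiv_comp [NormedSpace ℝ V] {P : E → V} {h : F → E} {x : F}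
    (hP : ContDiffAt ℝ ∞ P (h x)) (hh : ContDiffAt ℝ ∞ h x) (u v : F) :
    fderiv ℝ (fun y => fderiv ℝ (P ∘ h) y v) x u =
      fderiv ℝ (fderiv ℝ P) (h x) (fderiv ℝ h x u) (fderiv ℝ h x v) +
        fderiv ℝ P (h x) (fderiv ℝ (fun y => fderiv ℝ h y v) x u) := by
  have h1 : ∀ᶠ y in nhds x, DifferentiableAt ℝ h y :=
    ((hh.of_le (m := 1) (by norm_cast)).eventually (by norm_num)).mono
      fun y hy => hy.differentiableAt (by norm_num)
  have h2 : ∀ᶠ y in nhds x, DifferentiableAt ℝ P (h y) :=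
    hh.continuousAt.eventually (((hP.of_le (m := 1) (by norm_cast)).eventually (by norm_num)).mono
      fun y hy => hy.differentiableAt (by norm_num))
  have h3 : (fun y => fderiv ℝ (P ∘ h) y v) =ᶠ[nhds x]
      fun y => fderiv ℝ P (h y) (fderiv ℝ h y v) := by
    filter_upwards [h1, h2] with y hy1 hy2
    rw [fderiv_comp y hy2 hy1]
    rfl
  have h4 : DifferentiableAt ℝ (fun y => fderiv ℝ P (h y)) x :=
    hP.differentiableAt_fderiv.comp x h1.self_of_nhds
  have h5 : DifferentiableAt ℝ (fun y => fderiv ℝ h y v) x :=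
    hh.differentiableAt_fderiv.clm_apply (differentiableAt_const v)
  rw [h3.fderiv_eq, fderiv_clm_apply h4 h5]
  have h6 : fderiv ℝ (fun y => fderiv ℝ P (h y)) x =
      (fderiv ℝ (fderiv ℝ P) (h x)).comp (fderiv ℝ h x) :=
    fderiv_comp x hP.differentiableAt_fderiv h1.self_of_nhds
  simp [h6, add_comm]

theorem fderiv_warped_metric [InnerProductSpace ℝ V] {P : E → V} {T : E → ℝ} {f : ℝ → ℝ} {x : E}
    (hP : ContDiffAt ℝ ∞ P x) (hT : ContDiffAt ℝ ∞ T x) (hf : DifferentiableAt ℝ f (T x))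
    (a b c : E) :
    fderiv ℝ (fun y => f (T y) ^ 2 * ⟪fderiv ℝ P y b, fderiv ℝ P y c⟫_ℝ
      - fderiv ℝ T y b * fderiv ℝ T y c) x a =
    2 * f (T x) * deriv f (T x) * fderiv ℝ T x a * ⟪fderiv ℝ P x b, fderiv ℝ P x c⟫_ℝ
      + f (T x) ^ 2 * (⟪fderiv ℝ (fderiv ℝ P) x a b, fderiv ℝ P x c⟫_ℝ
        + ⟪fderiv ℝ P x b, fderiv ℝ (fderiv ℝ P) x a c⟫_ℝ)
      - (fderiv ℝ (fderiv ℝ T) x a b * fderiv ℝ T x c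
        + fderiv ℝ T x b * fderiv ℝ (fderiv ℝ T) x a c) := by
  have hP' : ∀ v, HasFDerivAt (fun y => fderiv ℝ P y v)
      (fderiv ℝ (fun y => fderiv ℝ P y v) x) x := fun v =>
    (hP.differentiableAt_fderiv.clm_apply (differentiableAt_const v)).hasFDerivAt
  have hT' : ∀ v, HasFDerivAt (fun y => fderiv ℝ T y v)
      (fderiv ℝ (fun y => fderiv ℝ T y v) x) x := fun v =>
    (hT.differentiableAt_fderiv.clm_apply (differentiableAt_const v)).hasFDerivAt
  have h1 : HasFDerivAt T (fderiv ℝ T x) x := (hT.differentiableAt (by simp)).hasFDerivAt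
  have h2 := (hf.hasDerivAt.comp_hasFDerivAt x h1).pow 2
  have h3 := (h2.mul ((hP' b).inner ℝ (hP' c))).sub ((hT' b).mul (hT' c))
  refine (congrArg (fun L : E →L[ℝ] ℝ => L a) h3.fderiv).trans ?_
  simp [fderiv_fderiv_apply hP, fderiv_fderiv_apply hT]
  ring

theorem fderiv_fderiv_symm [NormedSpace ℝ V] {P : E → V} {x : E} (hP : ContDiffAt ℝ ∞ P x)
    (a b : E) : fderiv ℝ (fderiv ℝ P) x a b = fderiv ℝ (fderiv ℝ P) x b a :=
  (hP.isSymmSndFDerivAt (by simp; norm_cast)).eq a b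

/-- When the metric is pulled back by `(T, P)` from a warped product, the Hessians of `P` and `T`
are symmetric, so in the Koszul combination all of them cancel except those at `(a, b)`. The
derivatives of `f²` give the terms with `f f'`. An equality of germs suffices for `G`, as only first
derivatives at `x` enter. -/
theorem koszul_warped_metric [InnerProductSpace ℝ V] {P : E → V} {T : E → ℝ} {f : ℝ → ℝ} {x : E}
    (hP : ContDiffAt ℝ ∞ P x) (hT : ContDiffAt ℝ ∞ T x) (hf : DifferentiableAt ℝ f (T x))
    {G : E → E → E → ℝ} (hG : ∀ v w, G v w =ᶠ[nhds x] fun y =>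
      f (T y) ^ 2 * ⟪fderiv ℝ P y v, fderiv ℝ P y w⟫_ℝ - fderiv ℝ T y v * fderiv ℝ T y w)
    (a b c : E) :
    (fderiv ℝ (G b c) x a + fderiv ℝ (G a c) x b - fderiv ℝ (G a b) x c) / 2 =
      f (T x) ^ 2 * ⟪fderiv ℝ (fderiv ℝ P) x a b, fderiv ℝ P x c⟫_ℝ
      - fderiv ℝ (fderiv ℝ T) x a b * fderiv ℝ T x c
      + f (T x) * deriv f (T x) * (fderiv ℝ T x a * ⟪fderiv ℝ P x b, fderiv ℝ P x c⟫_ℝ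
        + fderiv ℝ T x b * ⟪fderiv ℝ P x a, fderiv ℝ P x c⟫_ℝ
        - fderiv ℝ T x c * ⟪fderiv ℝ P x a, fderiv ℝ P x b⟫_ℝ) := by
  rw [(hG b c).fderiv_eq, (hG a c).fderiv_eq, (hG a b).fderiv_eq,
    fderiv_warped_metric hP hT hf, fderiv_warped_metric hP hT hf, fderiv_warped_metric hP hT hf,
    fderiv_fderiv_symm hP b a, fderiv_fderiv_symm hP c a, fderiv_fderiv_symm hP c b,
    fderiv_fderiv_symm hT b a, fderiv_fderiv_symm hT c a, fderiv_fderiv_symm hT c b,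
    real_inner_comm (fderiv ℝ (fderiv ℝ P) x a c) (fderiv ℝ P x b)]
  ring

end SecondDerivatives

/-! ### Functions and maps read in the preferred charts -/

section Charts

variable {E H M V : Type*} [NormedAddCommGroup E] [NormedSpace ℝ E] [TopologicalSpace H]
  {J : ModelWithCorners ℝ E H} [TopologicalSpace M] [ChartedSpace H M]
  [NormedAddCommGroup V] [NormedSpace ℝ V] {q : M → V}

theorem contMDiffAt_extChartAt_symm' [J.Boundaryless] [IsManifold J ∞ M]
    {p : M} {y : E} (hy : y ∈ (extChartAt J p).target) :
    ContMDiffAt 𝓘(ℝ, E) J ∞ (extChartAt J p).symm y :=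
  (contMDiffOn_extChartAt_symm p).contMDiffAt ((isOpen_extChartAt_target p).mem_nhds hy)

theorem contDiffAt_comp_extChartAt_symm [J.Boundaryless] [IsManifold J ∞ M]
    (hq : ContMDiff J 𝓘(ℝ, V) ∞ q) (p : M) :
    ContDiffAt ℝ ∞ (q ∘ (extChartAt J p).symm) (extChartAt J p p) :=
  (hq.contMDiffAt.comp _ (contMDiffAt_extChartAt_symm' (mem_extChartAt_target p))).contDiffAt

theorem mfderiv_comp_mfderiv_extChartAt_symm [J.Boundaryless] [IsManifold J ∞ M]
    (hq : ContMDiff J 𝓘(ℝ, V) ∞ q) {p : M} {y : E}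
    (hy : y ∈ (extChartAt J p).target) (v : E) :
    mfderiv J 𝓘(ℝ, V) q ((extChartAt J p).symm y)
      (mfderiv 𝓘(ℝ, E) J (extChartAt J p).symm y v) =
      fderiv ℝ (q ∘ (extChartAt J p).symm) y v := by
  rw [← mfderiv_eq_fderiv, mfderiv_comp y (hq.mdifferentiable (by simp) _)
    ((contMDiffAt_extChartAt_symm' hy).mdifferentiableAt (by simp))]
  rfl

theorem mfderiv_eq_fderiv_extChartAt_symm [J.Boundaryless]
    (hq : ContMDiff J 𝓘(ℝ, V) ∞ q) (p : M) :
    mfderiv J 𝓘(ℝ, V) q p = fderiv ℝ (q ∘ (extChartAt J p).symm) (extChartAt J p p) := by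
  rw [(hq.mdifferentiable (by simp) p).mfderiv, J.range_eq_univ, fderivWithin_univ]
  rfl

variable {F K S : Type*} [NormedAddCommGroup F] [NormedSpace ℝ F] [TopologicalSpace K]
  {I : ModelWithCorners ℝ F K} [TopologicalSpace S] [ChartedSpace K S] {φ : S → M}

theorem contDiffAt_writtenInExtChartAt [I.Boundaryless]
    (hφ : ContMDiff I J ∞ φ) (x : S) :
    ContDiffAt ℝ ∞ (writtenInExtChartAt I J x φ) (extChartAt I x x) := by
  have h := (contMDiffAt_iff.1 (hφ x)).2
  rwa [I.range_eq_univ, contDiffWithinAt_univ] at h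

theorem mfderiv_eq_fderiv_writtenInExtChartAt [I.Boundaryless]
    (hφ : ContMDiff I J ∞ φ) (x : S) :
    mfderiv I J φ x = fderiv ℝ (writtenInExtChartAt I J x φ) (extChartAt I x x) := by
  rw [(hφ.mdifferentiable (by simp) x).mfderiv, I.range_eq_univ, fderivWithin_univ]

theorem writtenInExtChartAt_apply_self (φ : S → M) (x : S) :
    writtenInExtChartAt I J x φ (extChartAt I x x) = extChartAt J (φ x) (φ x) := by
  simp [writtenInExtChartAt]

theorem comp_writtenInExtChartAt_eventuallyEq {W : Type*}
    (hφ : ContMDiff I J ∞ φ) (q : M → W) (x : S) :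
    (q ∘ φ) ∘ (extChartAt I x).symm =ᶠ[nhds (extChartAt I x x)]
      (q ∘ (extChartAt J (φ x)).symm) ∘ writtenInExtChartAt I J x φ := by
  have h1 : Filter.Tendsto (φ ∘ (extChartAt I x).symm) (nhds (extChartAt I x x))
      (nhds (φ x)) := by
    have := (hφ.continuous.continuousAt (x := (extChartAt I x).symm (extChartAt I x x))).comp
      (continuousAt_extChartAt_symm x)
    simpa [ContinuousAt] using this
  filter_upwards [h1 (extChartAt_source_mem_nhds (I := J) (φ x))] with y hy
  simp only [Function.comp, writtenInExtChartAt]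
  exact congrArg q ((extChartAt J (φ x)).left_inv hy).symm

/-- For a vector-valued function `q` on the target, this trades second derivatives of `φ` in charts,
which depend on the chart of `M`, for second derivatives of `q ∘ φ`, which do not. -/
theorem fderiv_fderiv_comp_extChartAt_symm [J.Boundaryless] [IsManifold J ∞ M]
    [I.Boundaryless] (hφ : ContMDiff I J ∞ φ)
    (hq : ContMDiff J 𝓘(ℝ, V) ∞ q) (x : S) (u v : F) :
    fderiv ℝ (fun y => fderiv ℝ ((q ∘ φ) ∘ (extChartAt I x).symm) y v) (extChartAt I x x) u =
      fderiv ℝ (fderiv ℝ (q ∘ (extChartAt J (φ x)).symm)) (extChartAt J (φ x) (φ x))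
        (fderiv ℝ (writtenInExtChartAt I J x φ) (extChartAt I x x) u)
        (fderiv ℝ (writtenInExtChartAt I J x φ) (extChartAt I x x) v) +
      fderiv ℝ (q ∘ (extChartAt J (φ x)).symm) (extChartAt J (φ x) (φ x))
        (fderiv ℝ (fun y => fderiv ℝ (writtenInExtChartAt I J x φ) y v)
          (extChartAt I x x) u) := by
  have h1 := (comp_writtenInExtChartAt_eventuallyEq (J := J) hφ q x).eventuallyEq_nhds
  have h2 : (fun y => fderiv ℝ ((q ∘ φ) ∘ (extChartAt I x).symm) y v)
      =ᶠ[nhds (extChartAt I x x)]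
      fun y => fderiv ℝ ((q ∘ (extChartAt J (φ x)).symm) ∘ writtenInExtChartAt I J x φ) y v := by
    filter_upwards [h1] with y hy
    rw [hy.fderiv_eq]
  have h3 := contDiffAt_comp_extChartAt_symm hq (φ x)
  rw [h2.fderiv_eq, fderiv_fderiv_comp
    (by rw [writtenInExtChartAt_apply_self]; exact h3) (contDiffAt_writtenInExtChartAt hφ x),
    writtenInExtChartAt_apply_self]

theorem fderiv_comp_extChartAt_symm [J.Boundaryless] [IsManifold J ∞ M]
    [I.Boundaryless] (hφ : ContMDiff I J ∞ φ)
    (hq : ContMDiff J 𝓘(ℝ, V) ∞ q) (x : S) (u : F) :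
    fderiv ℝ ((q ∘ φ) ∘ (extChartAt I x).symm) (extChartAt I x x) u =
      fderiv ℝ (q ∘ (extChartAt J (φ x)).symm) (extChartAt J (φ x) (φ x))
        (fderiv ℝ (writtenInExtChartAt I J x φ) (extChartAt I x x) u) := by
  have h := contDiffAt_comp_extChartAt_symm hq (φ x)
  rw [← writtenInExtChartAt_apply_self (I := I)] at h
  rw [(comp_writtenInExtChartAt_eventuallyEq (J := J) hφ q x).fderiv_eq,
    fderiv_comp _ (h.differentiableAt (by simp))
      ((contDiffAt_writtenInExtChartAt hφ x).differentiableAt (by simp)),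
    writtenInExtChartAt_apply_self]
  rfl

end Charts

/-! ### The Levi-Civita connection of `I ×_f S³` through its embedding in `ℝ × ℂ²` -/

noncomputable section FLRW

variable (I : TopologicalSpace.Opens ℝ)

/-- The time coordinate on `I × S³`. -/
def timeCoord (p : ClosedFLRW I) : ℝ := p.1

/-- The position in `ℂ²` of the second component of a point of `I × S³`. -/
def spaceCoord (p : ClosedFLRW I) : C2 := p.2

theorem contMDiff_timeCoord : ContMDiff flrwModel 𝓘(ℝ, ℝ) ∞ (timeCoord I) :=
  contMDiff_subtype_val.comp contMDiff_fst

theorem contMDiff_spaceCoord : ContMDiff flrwModel 𝓘(ℝ, C2) ∞ (spaceCoord I) :=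
  contMDiff_coe_sphere.comp contMDiff_snd

/-- The differential of the time coordinate. -/
def dTime (p : ClosedFLRW I) : ℝ × EuclideanSpace ℝ (Fin 3) →L[ℝ] ℝ :=
  fderiv ℝ (timeCoord I ∘ (extChartAt flrwModel p).symm) (extChartAt flrwModel p p)

/-- The differential of the position in `ℂ²`. -/
def dSpace (p : ClosedFLRW I) : ℝ × EuclideanSpace ℝ (Fin 3) →L[ℝ] C2 :=
  fderiv ℝ (spaceCoord I ∘ (extChartAt flrwModel p).symm) (extChartAt flrwModel p p)

variable {I}

theorem mfderiv_timeCoord (p : ClosedFLRW I) :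
    mfderiv flrwModel 𝓘(ℝ, ℝ) (timeCoord I) p = dTime I p :=
  mfderiv_eq_fderiv_extChartAt_symm (contMDiff_timeCoord I) p

theorem mfderiv_spaceCoord (p : ClosedFLRW I) :
    mfderiv flrwModel 𝓘(ℝ, C2) (spaceCoord I) p = dSpace I p :=
  mfderiv_eq_fderiv_extChartAt_symm (contMDiff_spaceCoord I) p

theorem flrwMetric_apply (f : ℝ → ℝ) (p : ClosedFLRW I) (v w : ℝ × EuclideanSpace ℝ (Fin 3)) :
    flrwMetric I f p v w =
      f p.1 ^ 2 * ⟪dSpace I p v, dSpace I p w⟫_ℝ - dTime I p v * dTime I p w := by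
  rw [← mfderiv_timeCoord, ← mfderiv_spaceCoord]
  rfl

theorem coordMetric_flrwMetric (f : ℝ → ℝ) (p : ClosedFLRW I)
    (v w : ℝ × EuclideanSpace ℝ (Fin 3)) :
    coordMetric (flrwMetric I f) p v w =ᶠ[nhds (extChartAt flrwModel p p)] fun y =>
      f ((timeCoord I ∘ (extChartAt flrwModel p).symm) y) ^ 2 *
        ⟪fderiv ℝ (spaceCoord I ∘ (extChartAt flrwModel p).symm) y v,
          fderiv ℝ (spaceCoord I ∘ (extChartAt flrwModel p).symm) y w⟫_ℝ -
        fderiv ℝ (timeCoord I ∘ (extChartAt flrwModel p).symm) y v *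
          fderiv ℝ (timeCoord I ∘ (extChartAt flrwModel p).symm) y w := by
  filter_upwards [extChartAt_target_mem_nhds (I := flrwModel) p] with y hy
  simp only [← mfderiv_comp_mfderiv_extChartAt_symm (contMDiff_timeCoord I) hy,
    ← mfderiv_comp_mfderiv_extChartAt_symm (contMDiff_spaceCoord I) hy]
  rfl

theorem christoffelFirst_flrwMetric {f : ℝ → ℝ} {p : ClosedFLRW I}
    (hf : DifferentiableAt ℝ f p.1) (a b c : ℝ × EuclideanSpace ℝ (Fin 3)) :
    christoffelFirst (flrwMetric I f) p a b c =
      f p.1 ^ 2 * ⟪fderiv ℝ (fderiv ℝ (spaceCoord I ∘ (extChartAt flrwModel p).symm))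
        (extChartAt flrwModel p p) a b, dSpace I p c⟫_ℝ
      - fderiv ℝ (fderiv ℝ (timeCoord I ∘ (extChartAt flrwModel p).symm))
        (extChartAt flrwModel p p) a b * dTime I p c
      + f p.1 * deriv f p.1 * (dTime I p a * ⟪dSpace I p b, dSpace I p c⟫_ℝ
        + dTime I p b * ⟪dSpace I p a, dSpace I p c⟫_ℝ
        - dTime I p c * ⟪dSpace I p a, dSpace I p b⟫_ℝ) := by
  have hP := contDiffAt_comp_extChartAt_symm (contMDiff_spaceCoord I) p
  have hT := contDiffAt_comp_extChartAt_symm (contMDiff_timeCoord I) p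
  have h0 : (timeCoord I ∘ (extChartAt flrwModel p).symm) (extChartAt flrwModel p p) = p.1 :=
    congrArg (timeCoord I) (extChartAt_to_inv p)
  have hf' : DifferentiableAt ℝ f
      ((timeCoord I ∘ (extChartAt flrwModel p).symm) (extChartAt flrwModel p p)) := by rwa [h0]
  have h := koszul_warped_metric hP hT hf' (coordMetric_flrwMetric f p) a b c
  rw [h0] at h
  exact h

variable {F K S : Type*} [NormedAddCommGroup F] [NormedSpace ℝ F] [TopologicalSpace K]
  {L : ModelWithCorners ℝ F K} [L.Boundaryless] [TopologicalSpace S] [ChartedSpace K S]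
  {φ : S → ClosedFLRW I}

theorem flrwMetric_mfderiv_right {f : ℝ → ℝ} (hφ : ContMDiff L flrwModel ∞ φ) (x : S)
    (w : ℝ × EuclideanSpace ℝ (Fin 3)) (u : F) :
    flrwMetric I f (φ x) w (mfderiv L flrwModel φ x u) =
      f (φ x).1 ^ 2 * ⟪dSpace I (φ x) w,
        fderiv ℝ ((spaceCoord I ∘ φ) ∘ (extChartAt L x).symm) (extChartAt L x x) u⟫_ℝ -
      dTime I (φ x) w *
        fderiv ℝ ((timeCoord I ∘ φ) ∘ (extChartAt L x).symm) (extChartAt L x x) u := by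
  rw [fderiv_comp_extChartAt_symm hφ (contMDiff_timeCoord I),
    fderiv_comp_extChartAt_symm hφ (contMDiff_spaceCoord I),
    mfderiv_eq_fderiv_writtenInExtChartAt hφ]
  exact flrwMetric_apply f (φ x) w _

theorem flrwMetric_mfderiv_mfderiv {f : ℝ → ℝ} (hφ : ContMDiff L flrwModel ∞ φ) (x : S)
    (u v : F) :
    flrwMetric I f (φ x) (mfderiv L flrwModel φ x u) (mfderiv L flrwModel φ x v) =
      f (φ x).1 ^ 2 *
        ⟪fderiv ℝ ((spaceCoord I ∘ φ) ∘ (extChartAt L x).symm) (extChartAt L x x) u,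
        fderiv ℝ ((spaceCoord I ∘ φ) ∘ (extChartAt L x).symm) (extChartAt L x x) v⟫_ℝ -
      fderiv ℝ ((timeCoord I ∘ φ) ∘ (extChartAt L x).symm) (extChartAt L x x) u *
        fderiv ℝ ((timeCoord I ∘ φ) ∘ (extChartAt L x).symm) (extChartAt L x x) v := by
  simp only [fderiv_comp_extChartAt_symm hφ (contMDiff_timeCoord I),
    fderiv_comp_extChartAt_symm hφ (contMDiff_spaceCoord I),
    mfderiv_eq_fderiv_writtenInExtChartAt hφ]
  exact flrwMetric_apply f (φ x) _ _

/-- The covariant second derivative of a map to `I ×_f S³`, in terms of the derivatives of its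
components in `I` and in `ℂ²`. -/
theorem covariantSecondDeriv_flrwMetric {f : ℝ → ℝ} {x : S} (hf : DifferentiableAt ℝ f (φ x).1)
    (hφ : ContMDiff L flrwModel ∞ φ) {T : F → ℝ} {Q : F → C2}
    (hT : T = (timeCoord I ∘ φ) ∘ (extChartAt L x).symm)
    (hQ : Q = (spaceCoord I ∘ φ) ∘ (extChartAt L x).symm)
    (u v : F) (w : ℝ × EuclideanSpace ℝ (Fin 3)) :
    covariantSecondDeriv (flrwMetric I f) L φ x u v w =
      f (φ x).1 ^ 2 * ⟪fderiv ℝ (fun y => fderiv ℝ Q y v) (extChartAt L x x) u,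
        dSpace I (φ x) w⟫_ℝ
      - fderiv ℝ (fun y => fderiv ℝ T y v) (extChartAt L x x) u * dTime I (φ x) w
      + f (φ x).1 * deriv f (φ x).1 *
        (fderiv ℝ T (extChartAt L x x) u *
            ⟪fderiv ℝ Q (extChartAt L x x) v, dSpace I (φ x) w⟫_ℝ
          + fderiv ℝ T (extChartAt L x x) v *
            ⟪fderiv ℝ Q (extChartAt L x x) u, dSpace I (φ x) w⟫_ℝ
          - dTime I (φ x) w * ⟪fderiv ℝ Q (extChartAt L x x) u,
              fderiv ℝ Q (extChartAt L x x) v⟫_ℝ) := by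
  have h1 := (congrArg₂ (· + ·)
    (flrwMetric_apply f (φ x) (fderiv ℝ (fun y => fderiv ℝ (writtenInExtChartAt L flrwModel x φ)
      y v) (extChartAt L x x) u) w)
    (christoffelFirst_flrwMetric hf
      (fderiv ℝ (writtenInExtChartAt L flrwModel x φ) (extChartAt L x x) u)
      (fderiv ℝ (writtenInExtChartAt L flrwModel x φ) (extChartAt L x x) v) w))
  refine Eq.trans ?_ (h1.trans ?_)
  · rw [← mfderiv_eq_fderiv_writtenInExtChartAt hφ]
    rfl
  -- The chain rule splits the Hessians of `T` and `Q` into a part from `coordSecondDeriv` and a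
  -- part from the Christoffel symbols.
  rw [hT, hQ,
    fderiv_fderiv_comp_extChartAt_symm hφ (contMDiff_timeCoord I),
    fderiv_fderiv_comp_extChartAt_symm hφ (contMDiff_spaceCoord I)]
  simp only [fderiv_comp_extChartAt_symm hφ (contMDiff_timeCoord I),
    fderiv_comp_extChartAt_symm hφ (contMDiff_spaceCoord I), inner_add_left]
  simp only [dTime, dSpace]
  ring

theorem dTime_apply (p : ClosedFLRW I) (v : ℝ × EuclideanSpace ℝ (Fin 3)) :
    dTime I p v = v.1 := by
  rw [dTime]
  have h : (timeCoord I ∘ (extChartAt flrwModel p).symm)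
      =ᶠ[nhds (extChartAt flrwModel p p)] Prod.fst := by
    filter_upwards [extChartAt_target_mem_nhds (I := flrwModel) p] with y hy
    rw [extChartAt_prod] at hy
    exact (extChartAt 𝓘(ℝ, ℝ) p.1).right_inv hy.1
  rw [h.fderiv_eq, fderiv_fst]
  rfl

theorem dSpace_apply (p : ClosedFLRW I) (v : ℝ × EuclideanSpace ℝ (Fin 3)) :
    dSpace I p v = mvfderiv (𝓡 3) (Subtype.val : S3 → C2) p.2 v.2 := by
  rw [← mfderiv_spaceCoord]
  have h := mfderiv_comp (I := flrwModel) (I' := 𝓡 3) (I'' := 𝓘(ℝ, C2)) (f := Prod.snd) p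
    ((contMDiff_coe_sphere (E := C2) (n := 3) (m := ∞)).mdifferentiable (by simp) p.2)
    (mdifferentiableAt_snd (I := 𝓘(ℝ, ℝ)) (I' := 𝓡 3))
  rw [mfderiv_snd] at h
  exact congrArg (fun A : ℝ × EuclideanSpace ℝ (Fin 3) →L[ℝ] C2 => A v) h

/-- The tangent vectors of `I × S³` are the pairs of a number and a vector orthogonal to the
position in `ℂ²`. -/
theorem exists_dTime_dSpace_eq (p : ClosedFLRW I) (a : ℝ) {X : C2}
    (hX : ⟪(p.2 : C2), X⟫_ℝ = 0) :
    ∃ v : ℝ × EuclideanSpace ℝ (Fin 3), dTime I p v = a ∧ dSpace I p v = X := by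
  obtain ⟨v, hv⟩ : X ∈ (mvfderiv (𝓡 3) (Subtype.val : S3 → C2) p.2).range := by
    rw [range_mvfderiv_subtypeVal]
    exact (Submodule.mem_orthogonal_singleton_iff_inner_right).2 hX
  exact ⟨(a, v), dTime_apply p _, (dSpace_apply p _).trans hv⟩

theorem inner_dSpace (p : ClosedFLRW I) (v : ℝ × EuclideanSpace ℝ (Fin 3)) :
    ⟪(p.2 : C2), dSpace I p v⟫_ℝ = 0 := by
  have h : dSpace I p v ∈ (mvfderiv (𝓡 3) (Subtype.val : S3 → C2) p.2).range :=
    ⟨v.2, (dSpace_apply p v).symm⟩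
  rw [range_mvfderiv_subtypeVal] at h
  exact (Submodule.mem_orthogonal_singleton_iff_inner_right).1 h

end FLRW

/-! ### Curves and maps into unit spheres -/

section UnitVectors

variable {F V : Type*} [NormedAddCommGroup F] [NormedSpace ℝ F] [NormedAddCommGroup V]
  [InnerProductSpace ℝ V]

/-- Differentiate `⟪ζ, ζ⟫ = 1` twice in the direction `u`. -/
theorem inner_fderiv_fderiv_of_norm_eq_one {ζ : F → V} {x : F} (hζ : ContDiffAt ℝ ∞ ζ x)
    (h : ∀ y, ‖ζ y‖ = 1) (u : F) :
    ⟪ζ x, fderiv ℝ (fun y => fderiv ℝ ζ y u) x u⟫_ℝ + ⟪fderiv ℝ ζ x u, fderiv ℝ ζ x u⟫_ℝ = 0 := by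
  have h1 : ∀ᶠ y in nhds x, DifferentiableAt ℝ ζ y :=
    ((hζ.of_le (m := 1) (by norm_cast)).eventually (by norm_num)).mono
      fun y hy => hy.differentiableAt (by norm_num)
  have h2 : (fun y => ⟪ζ y, fderiv ℝ ζ y u⟫_ℝ) =ᶠ[nhds x] fun _ => 0 := by
    filter_upwards [h1] with y hy
    have h3 := fderiv_inner_apply ℝ hy hy u
    have h4 : (fun y => ⟪ζ y, ζ y⟫_ℝ) = fun _ => 1 := by
      ext y
      rw [real_inner_self_eq_norm_sq, h, one_pow]
    rw [h4, real_inner_comm (ζ y)] at h3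
    simp only [fderiv_fun_const, Pi.zero_apply, zero_apply] at h3
    linarith
  have h6 : DifferentiableAt ℝ (fun y => fderiv ℝ ζ y u) x :=
    hζ.differentiableAt_fderiv.clm_apply (differentiableAt_const u)
  rw [← fderiv_inner_apply ℝ h1.self_of_nhds h6, h2.fderiv_eq]
  simp

end UnitVectors

/-! ### The fibre direction in the charts of the unit circle -/

noncomputable section CircleCharts

attribute [local instance] finrank_real_complex_fact'

theorem contMDiff_circle_coe : ContMDiff (𝓡 1) 𝓘(ℝ, ℂ) ∞ (fun z : Circle => (z : ℂ)) :=
  contMDiff_coe_sphere (E := ℂ)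

/-- The inverse of the chart of the unit circle at `z`, as a map to `ℂ`. -/
def circleChartSymm (z : Circle) : EuclideanSpace ℝ (Fin 1) → ℂ :=
  (fun z : Circle => (z : ℂ)) ∘ (extChartAt (𝓡 1) z).symm

theorem norm_circleChartSymm (z : Circle) (y : EuclideanSpace ℝ (Fin 1)) :
    ‖circleChartSymm z y‖ = 1 :=
  Circle.norm_coe _

theorem circleChartSymm_apply_self (z : Circle) :
    circleChartSymm z (extChartAt (𝓡 1) z z) = z :=
  congrArg (fun z : Circle => (z : ℂ)) (extChartAt_to_inv z)

theorem contDiffAt_circleChartSymm (z : Circle) :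
    ContDiffAt ℝ ∞ (circleChartSymm z) (extChartAt (𝓡 1) z z) :=
  contDiffAt_comp_extChartAt_symm contMDiff_circle_coe z

/-- The differential of the inclusion of the circle has the orthogonal complement of `z` as its
range, and `i z` lies in it. -/
theorem exists_fderiv_circleChartSymm_eq (z : Circle) :
    ∃ u : EuclideanSpace ℝ (Fin 1),
      fderiv ℝ (circleChartSymm z) (extChartAt (𝓡 1) z z) u = Complex.I * z := by
  obtain ⟨u, hu⟩ : Complex.I * (z : ℂ) ∈
      (mvfderiv (𝓡 1) (Subtype.val : Metric.sphere (0 : ℂ) 1 → ℂ)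
        (⟨z, mem_sphere_zero_iff_norm.2 (Circle.norm_coe z)⟩ : Metric.sphere (0 : ℂ) 1)).range := by
    rw [range_mvfderiv_subtypeVal]
    refine Submodule.mem_orthogonal_singleton_iff_inner_right.2 ?_
    simp [Complex.inner]
    ring
  refine ⟨u, Eq.trans ?_ hu⟩
  rw [circleChartSymm, ← mfderiv_eq_fderiv_extChartAt_symm contMDiff_circle_coe z]
  rfl

/-- The radial part `-1` is forced by the unit norm. The tangential part `m` depends on the chart
and is never computed: it multiplies a vector tangent to the surface, so normal vectors do not see
it. -/
theorem exists_fderiv_fderiv_circleChartSymm_eq {z : Circle} {u : EuclideanSpace ℝ (Fin 1)}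
    (hu : fderiv ℝ (circleChartSymm z) (extChartAt (𝓡 1) z z) u = Complex.I * z) :
    ∃ m : ℝ, fderiv ℝ (fun y => fderiv ℝ (circleChartSymm z) y u) (extChartAt (𝓡 1) z z) u =
      (-1 + m * Complex.I) * z := by
  have hζ := contDiffAt_circleChartSymm z
  set D := fderiv ℝ (fun y => fderiv ℝ (circleChartSymm z) y u) (extChartAt (𝓡 1) z z) u
  have h9 := inner_fderiv_fderiv_of_norm_eq_one hζ (norm_circleChartSymm z) u
  rw [circleChartSymm_apply_self, hu] at h9
  have h10 : Complex.normSq (z : ℂ) = 1 := Circle.normSq_coe z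
  refine ⟨(D * (starRingEnd ℂ) z).im, ?_⟩
  have h11 : (-1 + (D * (starRingEnd ℂ) z).im * Complex.I) = D * (starRingEnd ℂ) z := by
    have h12 : (D * (starRingEnd ℂ) z).re = -1 := by
      rw [real_inner_self_eq_norm_sq, norm_mul, Circle.norm_coe, Complex.norm_I,
        Complex.inner, Complex.mul_re] at h9
      simp only [Complex.mul_re, Complex.conj_re, Complex.conj_im] at h9 ⊢
      linarith
    apply Complex.ext
    · simpa using h12.symm
    · simp
  rw [h11, mul_assoc, ← Complex.normSq_eq_conj_mul_self, h10]
  simp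

end CircleCharts

/-! ### Derivatives of `(s, y) ↦ ζ y • β s` -/

section ScalarProducts

variable {F : Type*} [NormedAddCommGroup F] [NormedSpace ℝ F]

theorem fderiv_smul_prod_apply {ζ : F → ℂ} {β : ℝ → C2} {y : ℝ × F}
    (hζ : DifferentiableAt ℝ ζ y.2) (hβ : DifferentiableAt ℝ β y.1) (v : ℝ × F) :
    fderiv ℝ (fun y : ℝ × F => ζ y.2 • β y.1) y v =
      ζ y.2 • (v.1 • deriv β y.1) + fderiv ℝ ζ y.2 v.2 • β y.1 := by
  have h1 : HasFDerivAt (fun y : ℝ × F => ζ y.2) _ y := hζ.hasFDerivAt.comp y hasFDerivAt_snd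
  have h2 : HasFDerivAt (fun y : ℝ × F => β y.1) _ y :=
    hβ.hasDerivAt.hasFDerivAt.comp y hasFDerivAt_fst
  refine (congrArg (fun A : ℝ × F →L[ℝ] C2 => A v) (h1.smul h2).fderiv).trans ?_
  simp

theorem fderiv_fderiv_smul_prod_left {ζ : F → ℂ} {β : ℝ → C2} {y : ℝ × F}
    (hζ : ContDiffAt ℝ ∞ ζ y.2) (hβ : ContDiff ℝ ∞ β) :
    fderiv ℝ (fun y : ℝ × F => fderiv ℝ (fun y : ℝ × F => ζ y.2 • β y.1) y (1, 0)) y (1, 0) =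
      ζ y.2 • deriv (deriv β) y.1 := by
  have h1 : ∀ᶠ x : ℝ × F in nhds y, DifferentiableAt ℝ ζ x.2 :=
    continuousAt_snd.eventually
      (((hζ.of_le (m := 1) (by norm_cast)).eventually (by norm_num)).mono
        fun y hy => hy.differentiableAt (by norm_num))
  have h2 : (fun x : ℝ × F => fderiv ℝ (fun y : ℝ × F => ζ y.2 • β y.1) x (1, 0))
      =ᶠ[nhds y] fun x => ζ x.2 • deriv β x.1 := by
    filter_upwards [h1] with x hx
    rw [fderiv_smul_prod_apply hx (hβ.differentiable (by simp) _)]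
    simp
  have h3 : ContDiff ℝ ∞ (deriv β) := (contDiff_infty_iff_deriv.1 hβ).2
  rw [h2.fderiv_eq, fderiv_smul_prod_apply h1.self_of_nhds (h3.differentiable (by simp) _)]
  simp

theorem fderiv_fderiv_smul_prod_right {ζ : F → ℂ} {β : ℝ → C2} {y : ℝ × F}
    (hζ : ContDiffAt ℝ ∞ ζ y.2) (hβ : ContDiff ℝ ∞ β) (u v : F) :
    fderiv ℝ (fun y : ℝ × F => fderiv ℝ (fun y : ℝ × F => ζ y.2 • β y.1) y (0, u)) y (0, v) =
      fderiv ℝ (fun x => fderiv ℝ ζ x u) y.2 v • β y.1 := by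
  have h1 : ∀ᶠ x : ℝ × F in nhds y, DifferentiableAt ℝ ζ x.2 :=
    continuousAt_snd.eventually
      (((hζ.of_le (m := 1) (by norm_cast)).eventually (by norm_num)).mono
        fun y hy => hy.differentiableAt (by norm_num))
  have h2 : (fun x : ℝ × F => fderiv ℝ (fun y : ℝ × F => ζ y.2 • β y.1) x (0, u))
      =ᶠ[nhds y] fun x => fderiv ℝ ζ x.2 u • β x.1 := by
    filter_upwards [h1] with x hx
    rw [fderiv_smul_prod_apply hx (hβ.differentiable (by simp) _)]
    simp
  have h3 : DifferentiableAt ℝ (fun x => fderiv ℝ ζ x u) y.2 :=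
    hζ.differentiableAt_fderiv.clm_apply (differentiableAt_const u)
  rw [h2.fderiv_eq, fderiv_smul_prod_apply (ζ := fun x => fderiv ℝ ζ x u) h3
    (hβ.differentiable (by simp) _)]
  simp

theorem fderiv_comp_fst_apply {t : ℝ → ℝ} {y : ℝ × F} (ht : DifferentiableAt ℝ t y.1)
    (v : ℝ × F) : fderiv ℝ (fun y : ℝ × F => t y.1) y v = v.1 * deriv t y.1 := by
  have h2 : HasFDerivAt (fun y : ℝ × F => t y.1) _ y :=
    ht.hasDerivAt.hasFDerivAt.comp y hasFDerivAt_fst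
  rw [h2.fderiv]
  simp

theorem fderiv_fderiv_comp_fst {t : ℝ → ℝ} (ht : ContDiff ℝ ∞ t) (y u v : ℝ × F) :
    fderiv ℝ (fun y : ℝ × F => fderiv ℝ (fun y : ℝ × F => t y.1) y u) y v =
      u.1 * v.1 * deriv (deriv t) y.1 := by
  have h3 : ContDiff ℝ ∞ (deriv t) := (contDiff_infty_iff_deriv.1 ht).2
  have h : (fun y : ℝ × F => fderiv ℝ (fun y : ℝ × F => t y.1) y u) =
      fun y => (fun s => u.1 * deriv t s) y.1 := by
    ext y
    exact fderiv_comp_fst_apply (ht.differentiable (by simp) _) u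
  rw [h, fderiv_comp_fst_apply ((h3.differentiable (by simp) _).const_mul _),
    deriv_const_mul _ (h3.differentiable (by simp) _)]
  ring

end ScalarProducts

/-! ### Real inner products and complex scalars in `ℂ²` -/

section ComplexPlane

theorem real_inner_eq_re_inner_C2 (x y : C2) : ⟪x, y⟫_ℝ = (⟪x, y⟫_ℂ).re := by
  simp [PiLp.inner_apply, Fin.sum_univ_two]

theorem real_inner_circle_smul (z : Circle) (x y : C2) :
    ⟪(z : ℂ) • x, (z : ℂ) • y⟫_ℝ = ⟪x, y⟫_ℝ := by
  rw [real_inner_eq_re_inner_C2, real_inner_eq_re_inner_C2, inner_smul_left, inner_smul_right,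
    ← mul_assoc, ← Complex.normSq_eq_conj_mul_self, Circle.normSq_coe]
  simp

theorem real_inner_I_smul_left (x y : C2) : ⟪Complex.I • x, y⟫_ℝ = -⟪x, Complex.I • y⟫_ℝ := by
  rw [real_inner_eq_re_inner_C2, real_inner_eq_re_inner_C2, inner_smul_left, inner_smul_right]
  simp

theorem real_inner_I_smul_I_smul (x y : C2) :
    ⟪Complex.I • x, Complex.I • y⟫_ℝ = ⟪x, y⟫_ℝ := by
  rw [real_inner_I_smul_left, smul_smul]
  simp

theorem real_inner_I_smul_self_C2 (x : C2) : ⟪Complex.I • x, x⟫_ℝ = 0 := by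
  have := real_inner_I_smul_left x x
  rw [real_inner_comm (Complex.I • x)] at this
  linarith

end ComplexPlane

/-! ### Horizontal circles and the derivatives of their Hopf lifts -/

noncomputable section HopfSurface

attribute [local instance] finrank_real_complex_fact' in
theorem contMDiff_circle_smul {b : ℝ → S3} (hb : ContDiff ℝ ∞ (fun s => (b s : C2))) :
    ContMDiff surfaceModel 𝓘(ℝ, C2) ∞
      (fun x : ℝ × Circle => ((x.2 : ℂ) • (b x.1 : C2))) := by
  have h1 : ContMDiff surfaceModel 𝓘(ℝ, ℂ) ∞ (fun x : ℝ × Circle => (x.2 : ℂ)) :=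
    contMDiff_circle_coe.comp contMDiff_snd
  have h2 : ContMDiff surfaceModel 𝓘(ℝ, C2) ∞ (fun x : ℝ × Circle => (b x.1 : C2)) :=
    hb.contMDiff.comp contMDiff_fst
  have h3 : ContDiff ℝ ∞ (fun p : ℂ × C2 => p.1 • p.2) := contDiff_fst.smul contDiff_snd
  exact h3.contMDiff.comp (h1.prodMk_space h2)

theorem contMDiff_sineTime : ContMDiff 𝓘(ℝ, ℝ) 𝓘(ℝ, ℝ) ∞ sineTime := by
  intro s
  rw [contMDiffAt_iff_target]
  exact ⟨(Real.continuous_sin.subtype_mk _).continuousAt,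
    (Real.contDiff_sin (n := ∞)).contMDiff.contMDiffAt⟩

theorem contMDiff_hopfLift {b : ℝ → S3} (hb : ContDiff ℝ ∞ (fun s => (b s : C2))) :
    ContMDiff surfaceModel flrwModel ∞ (hopfLift sineTime b) := by
  refine (contMDiff_sineTime.comp contMDiff_fst).prodMk ?_
  exact (contMDiff_circle_smul hb).codRestrict_sphere (fun x => (circleAction x.2 (b x.1)).2)

theorem spaceCoord_hopfLift_chart (b : ℝ → S3) (x : ℝ × Circle) :
    (spaceCoord timeInterval ∘ hopfLift sineTime b) ∘ (extChartAt surfaceModel x).symm =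
      fun y => circleChartSymm x.2 y.2 • (b y.1 : C2) := rfl

theorem timeCoord_hopfLift_chart (b : ℝ → S3) (x : ℝ × Circle) :
    (timeCoord timeInterval ∘ hopfLift sineTime b) ∘ (extChartAt surfaceModel x).symm =
      fun y => Real.sin y.1 := rfl

/-- A unit speed curve in the unit sphere of `ℂ²`, horizontal for the Hopf map, whose
acceleration in the sphere is `k` times its velocity rotated by `i`. -/
structure IsHorizontalCircle (k : ℝ) (B : ℝ → C2) : Prop where
  contDiff : ContDiff ℝ ∞ B
  norm_eq_one : ∀ u, ‖B u‖ = 1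
  norm_deriv : ∀ u, ‖deriv B u‖ = 1
  inner_I_smul : ∀ u, ⟪deriv B u, Complex.I • B u⟫_ℝ = 0
  deriv_deriv : ∀ u, deriv (deriv B) u = -B u + k • (Complex.I • deriv B u)

theorem IsHorizontalCircle.inner_deriv {k : ℝ} {B : ℝ → C2} (hB : IsHorizontalCircle k B)
    (u : ℝ) : ⟪B u, deriv B u⟫_ℝ = 0 := by
  have h1 := (hB.contDiff.differentiable (by simp) u).hasDerivAt
  have h2 := (h1.inner ℝ h1).deriv
  have h3 : (fun u => ⟪B u, B u⟫_ℝ) = fun _ => 1 := by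
    ext u
    rw [real_inner_self_eq_norm_sq, hB.norm_eq_one, one_pow]
  rw [h3, deriv_const, real_inner_comm (B u) (deriv B u)] at h2
  linarith

theorem deriv_comp_of_contDiff {B : ℝ → C2} {σ : ℝ → ℝ} (hB : ContDiff ℝ ∞ B)
    (hσ : ContDiff ℝ ∞ σ) (s : ℝ) :
    deriv (fun s => B (σ s)) s = deriv σ s • deriv B (σ s) :=
  ((hB.differentiable (by simp) _).hasDerivAt.scomp s
    (hσ.differentiable (by simp) s).hasDerivAt).deriv

theorem deriv_deriv_comp_of_contDiff {B : ℝ → C2} {σ : ℝ → ℝ} (hB : ContDiff ℝ ∞ B)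
    (hσ : ContDiff ℝ ∞ σ) (s : ℝ) :
    deriv (deriv fun s => B (σ s)) s =
      deriv (deriv σ) s • deriv B (σ s) + deriv σ s ^ 2 • deriv (deriv B) (σ s) := by
  have hB' : ContDiff ℝ ∞ (deriv B) := (contDiff_infty_iff_deriv.1 hB).2
  have hσ' : ContDiff ℝ ∞ (deriv σ) := (contDiff_infty_iff_deriv.1 hσ).2
  have h : deriv (fun s => B (σ s)) = fun s => deriv σ s • deriv B (σ s) :=
    funext (deriv_comp_of_contDiff hB hσ)
  have h1 : DifferentiableAt ℝ (fun s => deriv B (σ s)) s :=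
    (hB'.comp hσ).differentiable (by simp) s
  rw [h, deriv_fun_smul (hσ'.differentiable (by simp) s) h1, deriv_comp_of_contDiff hB' hσ,
    smul_smul, add_comm, sq]

/-- A frame of the surface `ℝ × S¹` at `x`, orthogonal for the metric induced by a Hopf lift,
together with the first and second derivatives of the Hopf lift in that frame. -/
theorem exists_hopfLift_frame {k : ℝ} {B : ℝ → C2} {σ : ℝ → ℝ} {b : ℝ → S3}
    (hB : IsHorizontalCircle k B) (hσ : ContDiff ℝ ∞ σ) (hb : ∀ s, (b s : C2) = B (σ s))
    (x : ℝ × Circle) {Q : ℝ × EuclideanSpace ℝ (Fin 1) → C2}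
    (hQ : Q = (spaceCoord timeInterval ∘ hopfLift sineTime b) ∘ (extChartAt surfaceModel x).symm) :
    ∃ (u : EuclideanSpace ℝ (Fin 1)) (m : ℝ) (q X : C2),
      q = (hopfLift sineTime b x).2 ∧ ‖q‖ = 1 ∧ ‖X‖ = 1 ∧ ⟪q, X⟫_ℝ = 0 ∧
      ⟪X, Complex.I • q⟫_ℝ = 0 ∧
      (∀ v, ∃ r : ℝ, v = r • u) ∧
      (∀ a r : ℝ, fderiv ℝ Q (extChartAt surfaceModel x x) (a, r • u) =
        (a * deriv σ x.1) • X + r • Complex.I • q) ∧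
      fderiv ℝ (fun y => fderiv ℝ Q y (1, 0)) (extChartAt surfaceModel x x) (1, 0) =
        deriv (deriv σ) x.1 • X + deriv σ x.1 ^ 2 • (-q + k • Complex.I • X) ∧
      ∀ r : ℝ, fderiv ℝ (fun y => fderiv ℝ Q y (0, r • u)) (extChartAt surfaceModel x x)
        (0, r • u) = r ^ 2 • (-q + m • Complex.I • q) := by
  obtain ⟨s, z⟩ := x
  obtain ⟨u, hu⟩ := exists_fderiv_circleChartSymm_eq z
  obtain ⟨m, hm⟩ := exists_fderiv_fderiv_circleChartSymm_eq hu
  have hu0 : u ≠ 0 := by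
    rintro rfl
    simp at hu
  have hz := norm_circleChartSymm z
  have hβ : ContDiff ℝ ∞ (fun s => B (σ s)) := hB.contDiff.comp hσ
  have hQ' : Q = fun y => circleChartSymm z y.2 • B (σ y.1) := by
    rw [hQ, spaceCoord_hopfLift_chart]
    simp only [hb]
  have h0 : extChartAt surfaceModel (s, z) (s, z) = (s, extChartAt (𝓡 1) z z) := rfl
  have hζ := contDiffAt_circleChartSymm z
  -- The position and the velocity of `B` are rotated along the fibre by `z`, which preserves inner
  -- products and commutes with `i`.
  refine ⟨u, m, (z : ℂ) • B (σ s), (z : ℂ) • deriv B (σ s), ?_, ?_, ?_, ?_, ?_, ?_, ?_, ?_, ?_⟩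
  · rw [← hb]
    rfl
  · rw [norm_smul, hB.norm_eq_one, Circle.norm_coe, one_mul]
  · rw [norm_smul, hB.norm_deriv, Circle.norm_coe, one_mul]
  · rw [real_inner_circle_smul, hB.inner_deriv]
  · rw [smul_comm, real_inner_circle_smul, hB.inner_I_smul]
  · intro v
    obtain ⟨r, hr⟩ := exists_smul_eq_of_finrank_eq_one (K := ℝ) (by simp) hu0 v
    exact ⟨r, hr.symm⟩
  · intro a r
    rw [h0, hQ', fderiv_smul_prod_apply (hζ.differentiableAt (by simp))
      (hβ.differentiable (by simp) _), deriv_comp_of_contDiff hB.contDiff hσ]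
    rw [map_smul, hu, circleChartSymm_apply_self, smul_assoc, mul_smul, mul_smul,
      smul_comm (z : ℂ) a, smul_comm (z : ℂ) (deriv σ s)]
  · rw [h0, hQ', fderiv_fderiv_smul_prod_left hζ hβ,
      deriv_deriv_comp_of_contDiff hB.contDiff hσ, hB.deriv_deriv]
    simp only [circleChartSymm_apply_self, smul_add, smul_neg, smul_comm (z : ℂ) (_ : ℝ),
      smul_comm (z : ℂ) Complex.I]
  · intro r
    have h1 : (fun y => fderiv ℝ (circleChartSymm z) y (r • u)) =
        fun y => r • fderiv ℝ (circleChartSymm z) y u := by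
      ext y
      simp
    rw [h0, hQ', fderiv_fderiv_smul_prod_right hζ hβ, h1,
      fderiv_fun_const_smul (hζ.differentiableAt_fderiv.clm_apply (differentiableAt_const u))]
    simp only [FunLike.coe_smul, Pi.smul_apply, map_smul, hm]
    rw [smul_assoc, smul_assoc, mul_smul, add_smul, neg_smul, one_smul, mul_smul,
      Complex.coe_smul, smul_smul, ← sq]

end HopfSurface

/-! ### The mean curvature vector of the Hopf lift -/

noncomputable section MarginallyTrapped

/-- The `N₂`-component of the mean curvature equation, where `w` and `a` are the time component of a
normal vector and its component along `X`. By `h4` the pair `(w, a)` is a multiple `l` of `(F² v,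
c)`, so a single scalar equation remains. Eliminating `v'` by `h2`, the derivative of the unit speed
relation `h1`, turns it into the differential equation `h3`. -/
theorem mean_curvature_identity {F F' v v' S c k w a : ℝ} (hF : 0 < F) (hv : 0 < v)
    (h1 : F ^ 2 * v ^ 2 = 1 + c ^ 2) (h2 : F * F' * c * v ^ 2 + F ^ 2 * v * v' = -(S * c))
    (h3 : 2 * F' * (1 + c ^ 2) = S * F + F * v * k * (1 + c ^ 2)) (h4 : F ^ 2 * v * a = w * c) :
    k * v ^ 2 * F ^ 2 * (c * a - v * w) =
      F ^ 2 * v' * a + S * w + 2 * F * F' * c * v * a - F * F' * v ^ 2 * w - F' / F * w := by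
  obtain ⟨l, rfl⟩ : ∃ l, w = l * (F ^ 2 * v) := ⟨w / (F ^ 2 * v), by field_simp⟩
  obtain rfl : a = l * c := by
    have : F ^ 2 * v ≠ 0 := by positivity
    apply mul_left_cancel₀ this
    linarith
  have h5 : F' / F * (l * (F ^ 2 * v)) = F' * F * v * l := by
    field_simp
  rw [h5]
  apply mul_left_cancel₀ (mul_pos hF hv).ne'
  linear_combination l * (h3 + (F' * (2 + F ^ 2 * v ^ 2) - S * F -
    F * v * k * (1 + F ^ 2 * v ^ 2)) * h1 - c * F * h2)

theorem exists_basis_fin_two {E : Type*} [AddCommGroup E] [Module ℝ E]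
    (hE : Module.finrank ℝ E = 2) {e₁ e₂ : E}
    (h : ∀ a b : ℝ, a • e₁ + b • e₂ = 0 → a = 0 ∧ b = 0) :
    ∃ e : Module.Basis (Fin 2) ℝ E, e 0 = e₁ ∧ e 1 = e₂ := by
  have h1 : LinearIndependent ℝ ![e₁, e₂] := LinearIndependent.pair_iff.2 h
  refine ⟨basisOfLinearIndependentOfCardEqFinrank h1 (by simp [hE]), ?_, ?_⟩ <;> simp

variable {k : ℝ} {f : ℝ → ℝ} {B : ℝ → C2} {σ : ℝ → ℝ} {b : ℝ → S3}

theorem isMarginallyTrapped_hopfLift (hk : 0 < k) (hB : IsHorizontalCircle k B)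
    (hσ : ContDiff ℝ ∞ σ) (hb : ∀ s, (b s : C2) = B (σ s)) (hσ' : ∀ s, 0 < deriv σ s)
    (hf : ∀ s, DifferentiableAt ℝ f (Real.sin s)) (hpos : ∀ s, 0 < f (Real.sin s))
    (hunit : ∀ s, f (Real.sin s) ^ 2 * deriv σ s ^ 2 = 1 + Real.cos s ^ 2)
    (hode : ∀ s, 2 * deriv f (Real.sin s) * (1 + Real.cos s ^ 2) = Real.sin s * f (Real.sin s) +
      f (Real.sin s) * deriv σ s * k * (1 + Real.cos s ^ 2)) :
    IsMarginallyTrapped (flrwMetric timeInterval f) surfaceModel (hopfLift sineTime b) := by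
  have hφ : ContMDiff surfaceModel flrwModel ∞ (hopfLift sineTime b) := by
    refine contMDiff_hopfLift ?_
    simp only [hb]
    exact hB.contDiff.comp hσ
  -- Half the derivative of `hunit`; it determines `σ''`.
  have hσ2 : ∀ s, f (Real.sin s) * deriv f (Real.sin s) * Real.cos s * deriv σ s ^ 2 +
      f (Real.sin s) ^ 2 * deriv σ s * deriv (deriv σ) s = -(Real.sin s * Real.cos s) := by
    intro s
    have h1 : HasDerivAt (fun s => f (Real.sin s)) (deriv f (Real.sin s) * Real.cos s) s :=
      (hf s).hasDerivAt.comp s (Real.hasDerivAt_sin s)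
    have h2 : HasDerivAt (deriv σ) (deriv (deriv σ) s) s :=
      ((contDiff_infty_iff_deriv.1 hσ).2.differentiable (by simp) s).hasDerivAt
    have h3 := ((h1.fun_pow 2).fun_mul (h2.fun_pow 2)).deriv
    have h4 := (((Real.hasDerivAt_cos s).fun_pow 2).const_add 1).deriv
    rw [funext hunit, h4] at h3
    norm_num at h3
    linarith
  -- All the data at `x` in the frame `(1, 0)`, `(0, u)`. Second derivatives are recorded only
  -- against `w` orthogonal to the fibre direction `i q`, which removes the unknown `m`.
  have key : ∀ x : ℝ × Circle, ∃ (u : EuclideanSpace ℝ (Fin 1)) (q X : C2),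
      (‖q‖ = 1 ∧ ‖X‖ = 1 ∧ ⟪q, X⟫_ℝ = 0 ∧ ⟪X, Complex.I • q⟫_ℝ = 0) ∧
      q = (hopfLift sineTime b x).2 ∧
      (∀ v, ∃ r : ℝ, v = r • u) ∧
      (∀ a r a' r' : ℝ, flrwMetric timeInterval f (hopfLift sineTime b x)
        (mfderiv surfaceModel flrwModel (hopfLift sineTime b) x
          ((a, r • u) : ℝ × EuclideanSpace ℝ (Fin 1)))
        (mfderiv surfaceModel flrwModel (hopfLift sineTime b) x
          ((a', r' • u) : ℝ × EuclideanSpace ℝ (Fin 1))) =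
        a * a' + f (Real.sin x.1) ^ 2 * (r * r')) ∧
      (∀ (w : ℝ × EuclideanSpace ℝ (Fin 3)) (a r : ℝ),
        flrwMetric timeInterval f (hopfLift sineTime b x) w
        (mfderiv surfaceModel flrwModel (hopfLift sineTime b) x
          ((a, r • u) : ℝ × EuclideanSpace ℝ (Fin 1))) =
        f (Real.sin x.1) ^ 2 * (a * deriv σ x.1 *
            ⟪X, dSpace timeInterval (hopfLift sineTime b x) w⟫_ℝ +
          r * ⟪Complex.I • q, dSpace timeInterval (hopfLift sineTime b x) w⟫_ℝ) -
        dTime timeInterval (hopfLift sineTime b x) w * (a * Real.cos x.1)) ∧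
      ∀ w : ℝ × EuclideanSpace ℝ (Fin 3),
        ⟪Complex.I • q, dSpace timeInterval (hopfLift sineTime b x) w⟫_ℝ = 0 →
        covariantSecondDeriv (flrwMetric timeInterval f) surfaceModel (hopfLift sineTime b) x
            ((1, 0) : ℝ × EuclideanSpace ℝ (Fin 1)) ((1, 0) : ℝ × EuclideanSpace ℝ (Fin 1)) w =
          f (Real.sin x.1) ^ 2 *
            (deriv (deriv σ) x.1 * ⟪X, dSpace timeInterval (hopfLift sineTime b x) w⟫_ℝ +
              deriv σ x.1 ^ 2 * k *
                ⟪Complex.I • X, dSpace timeInterval (hopfLift sineTime b x) w⟫_ℝ) +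
          Real.sin x.1 * dTime timeInterval (hopfLift sineTime b x) w +
          f (Real.sin x.1) * deriv f (Real.sin x.1) *
            (2 * Real.cos x.1 * deriv σ x.1 *
                ⟪X, dSpace timeInterval (hopfLift sineTime b x) w⟫_ℝ -
              dTime timeInterval (hopfLift sineTime b x) w * deriv σ x.1 ^ 2) ∧
        ∀ r : ℝ,
        covariantSecondDeriv (flrwMetric timeInterval f) surfaceModel (hopfLift sineTime b) x
            ((0, r • u) : ℝ × EuclideanSpace ℝ (Fin 1))
            ((0, r • u) : ℝ × EuclideanSpace ℝ (Fin 1)) w =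
          -(f (Real.sin x.1) * deriv f (Real.sin x.1) *
            dTime timeInterval (hopfLift sineTime b x) w * r ^ 2) := by
    intro x
    obtain ⟨u, m, q, X, hq, hq1, hX1, hqX, hXq, hu, hd, hd1, hd2⟩ :=
      exists_hopfLift_frame hB hσ hb x rfl
    have hT : ∀ v : ℝ × EuclideanSpace ℝ (Fin 1),
        fderiv ℝ ((timeCoord timeInterval ∘ hopfLift sineTime b) ∘
          (extChartAt surfaceModel x).symm) (extChartAt surfaceModel x x) v =
          v.1 * Real.cos x.1 := fun v => by
      rw [timeCoord_hopfLift_chart, fderiv_comp_fst_apply Real.differentiable_sin.differentiableAt,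
        Real.deriv_sin]
      rfl
    have hT2 : ∀ v : ℝ × EuclideanSpace ℝ (Fin 1),
        fderiv ℝ (fun y => fderiv ℝ ((timeCoord timeInterval ∘ hopfLift sineTime b) ∘
          (extChartAt surfaceModel x).symm) y v) (extChartAt surfaceModel x x) v =
          -(v.1 * v.1 * Real.sin x.1) := fun v => by
      rw [timeCoord_hopfLift_chart, fderiv_fderiv_comp_fst Real.contDiff_sin, Real.deriv_sin,
        Real.deriv_cos, mul_neg]
      rfl
    have hsin : ((hopfLift sineTime b x).1 : ℝ) = Real.sin x.1 := rfl
    have hXX : ⟪X, X⟫_ℝ = 1 := by rw [real_inner_self_eq_norm_sq, hX1, one_pow]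
    have hqq : ⟪q, q⟫_ℝ = 1 := by rw [real_inner_self_eq_norm_sq, hq1, one_pow]
    have hqX' : ⟪Complex.I • q, X⟫_ℝ = 0 := by rw [real_inner_comm, hXq]
    -- Tangent vectors of `S³` are orthogonal to the position, so the `-q` parts of the
    -- accelerations in `ℂ²` drop out.
    have hqw : ∀ w, ⟪q, dSpace timeInterval (hopfLift sineTime b x) w⟫_ℝ = 0 := fun w => by
      rw [hq, inner_dSpace]
    have hd0 := hd 1 0
    have hdr : ∀ r, _ := hd 0
    simp only [zero_smul, add_zero, one_mul, zero_mul, zero_add] at hd0 hdr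
    refine ⟨u, q, X, ⟨hq1, hX1, hqX, hXq⟩, hq, hu, fun a r a' r' => ?_, fun w a r => ?_,
      fun w hw => ⟨?_, fun r => ?_⟩⟩
    · rw [flrwMetric_mfderiv_mfderiv hφ, hT, hT, hd, hd, hsin]
      simp only [inner_add_left, inner_add_right, real_inner_smul_left, real_inner_smul_right,
        hXX, hXq, hqX', real_inner_I_smul_I_smul, hqq]
      linear_combination (a * a') * hunit x.1
    · rw [flrwMetric_mfderiv_right hφ, hT, hd, hsin, inner_add_right, real_inner_smul_right,
        real_inner_smul_right, real_inner_comm X, real_inner_comm (Complex.I • q)]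
    · rw [covariantSecondDeriv_flrwMetric (hf x.1) hφ rfl rfl, hT2, hT, hd0, hd1, hsin]
      simp only [inner_add_left, inner_neg_left, real_inner_smul_left, real_inner_smul_right, hqw,
        hXX]
      ring
    · rw [covariantSecondDeriv_flrwMetric (hf x.1) hφ rfl rfl, hT2, hT, hdr, hd2, hsin]
      simp only [inner_add_left, inner_neg_left, real_inner_smul_left, real_inner_smul_right, hqw,
        hw, real_inner_I_smul_I_smul, hqq]
      ring
  refine ⟨⟨hφ, fun x v hv => ?_⟩, fun x => ?_⟩
  · obtain ⟨u, q, X, -, -, hu, hg, -⟩ := key x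
    obtain ⟨a, v'⟩ := v
    obtain ⟨r, rfl⟩ := hu v'
    rw [hg]
    have hfx := hpos x.1
    have hr2 := mul_self_nonneg r
    rcases eq_or_ne a 0 with rfl | ha
    · have hr : r ≠ 0 := by
        rintro rfl
        exact hv (by rw [zero_smul]; rfl)
      have := mul_self_pos.2 hr
      positivity
    · have := mul_self_pos.2 ha
      positivity
  · obtain ⟨u, q, X, ⟨hq1, hX1, hqX, hXq⟩, hq, hu, hg, hn, hc⟩ := key x
    set p := hopfLift sineTime b x with hp
    set F := f (Real.sin x.1) with hF
    set V := deriv σ x.1 with hV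
    have hF0 : 0 < F := hpos x.1
    have hV0 : 0 < V := hσ' x.1
    have hXX : ⟪X, X⟫_ℝ = 1 := by rw [real_inner_self_eq_norm_sq, hX1, one_pow]
    have hqX' : ⟪Complex.I • X, q⟫_ℝ = 0 := by
      rw [real_inner_I_smul_left, hXq, neg_zero]
    have hIX : ⟪Complex.I • X, X⟫_ℝ = 0 := real_inner_I_smul_self_C2 X
    -- The vector `(k F V² / 2) (N₁ + N₂)`, written in its time and space components.
    obtain ⟨H, hH1, hH2⟩ := exists_dTime_dSpace_eq p (k * V ^ 2 / 2 * (F ^ 2 * V))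
      (X := (k * V ^ 2 / 2) • (Complex.I • X + Real.cos x.1 • X)) (by
        rw [← hq, real_inner_smul_right, inner_add_right, real_inner_smul_right, hqX,
          real_inner_comm, hqX']
        simp)
    have hgH : ∀ w : ℝ × EuclideanSpace ℝ (Fin 3), flrwMetric timeInterval f p H w =
        k * V ^ 2 / 2 * F ^ 2 * (⟪Complex.I • X, dSpace timeInterval p w⟫_ℝ +
          Real.cos x.1 * ⟪X, dSpace timeInterval p w⟫_ℝ - V * dTime timeInterval p w) := by
      intro w
      rw [flrwMetric_apply, hH1, hH2, real_inner_smul_left, inner_add_left, real_inner_smul_left]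
      change F ^ 2 * _ - _ = _
      ring
    -- Orthogonality to `(1, 0)` and to `(0, u)`, respectively.
    have hnormal : ∀ w : ℝ × EuclideanSpace ℝ (Fin 3),
        IsNormalTo (flrwMetric timeInterval f) surfaceModel (hopfLift sineTime b) x w →
        F ^ 2 * V * ⟪X, dSpace timeInterval p w⟫_ℝ = dTime timeInterval p w * Real.cos x.1 ∧
        ⟪Complex.I • q, dSpace timeInterval p w⟫_ℝ = 0 := by
      intro w hw
      have h1 := (hn w 1 0).symm.trans (hw _)
      have h2 := (hn w 0 1).symm.trans (hw _)
      have hF2 : F ^ 2 ≠ 0 := by positivity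
      constructor
      · linarith
      · simpa [hF0.ne'] using h2
    have hu0 : u ≠ 0 := by
      rintro rfl
      have h1 := hg 0 1 0 1
      have h2 := hg 0 0 0 0
      rw [smul_zero] at h1 h2
      rw [h1] at h2
      simp [hF0.ne'] at h2
    -- The first vector is already unit by `hunit`; the fibre vector has length `F`. Writing `(0 :
    -- ℝ) • u` keeps the form to which `hg` applies.
    obtain ⟨e, he1, he2⟩ := exists_basis_fin_two (E := ℝ × EuclideanSpace ℝ (Fin 1)) (by simp)
      (e₁ := (1, (0 : ℝ) • u)) (e₂ := (0, F⁻¹ • u)) (by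
        intro a r h
        simp only [Prod.smul_mk, Prod.mk_add_mk, Prod.mk_eq_zero] at h
        simpa [hu0, hF0.ne'] using h)
    refine ⟨H, ⟨?_, e, ?_, ?_⟩, ?_, ?_⟩
    · rintro ⟨a, v⟩
      obtain ⟨r, rfl⟩ := hu v
      rw [hn H a r, hH1, hH2]
      simp only [inner_add_right, real_inner_smul_right, hXX]
      rw [real_inner_comm _ X, hIX, real_inner_I_smul_I_smul, hqX, real_inner_comm X, hXq]
      ring
    · intro i j
      fin_cases i <;> fin_cases j
      · exact (congrArg₂ (fun v w : ℝ × EuclideanSpace ℝ (Fin 1) => flrwMetric timeInterval f p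
          (mfderiv surfaceModel flrwModel (hopfLift sineTime b) x v)
          (mfderiv surfaceModel flrwModel (hopfLift sineTime b) x w)) he1 he1).trans
          ((hg _ _ _ _).trans (by simp))
      · exact (congrArg₂ (fun v w : ℝ × EuclideanSpace ℝ (Fin 1) => flrwMetric timeInterval f p
          (mfderiv surfaceModel flrwModel (hopfLift sineTime b) x v)
          (mfderiv surfaceModel flrwModel (hopfLift sineTime b) x w)) he1 he2).trans
          ((hg _ _ _ _).trans (by simp))
      · exact (congrArg₂ (fun v w : ℝ × EuclideanSpace ℝ (Fin 1) => flrwMetric timeInterval f p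
          (mfderiv surfaceModel flrwModel (hopfLift sineTime b) x v)
          (mfderiv surfaceModel flrwModel (hopfLift sineTime b) x w)) he2 he1).trans
          ((hg _ _ _ _).trans (by simp))
      · exact (congrArg₂ (fun v w : ℝ × EuclideanSpace ℝ (Fin 1) => flrwMetric timeInterval f p
          (mfderiv surfaceModel flrwModel (hopfLift sineTime b) x v)
          (mfderiv surfaceModel flrwModel (hopfLift sineTime b) x w)) he2 he2).trans
          ((hg _ _ _ _).trans (by simp; field_simp))
    · intro w hw
      obtain ⟨h1, h2⟩ := hnormal w hw
      obtain ⟨hc1, hc2⟩ := hc w h2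
      rw [zero_smul] at he1
      have hs : ∑ i, covariantSecondDeriv (flrwMetric timeInterval f) surfaceModel
          (hopfLift sineTime b) x (e i) (e i) w = _ :=
        (Fin.sum_univ_two _).trans (congrArg₂ (· + ·)
          ((congrArg (fun v : ℝ × EuclideanSpace ℝ (Fin 1) => covariantSecondDeriv
            (flrwMetric timeInterval f) surfaceModel (hopfLift sineTime b) x v v w) he1).trans hc1)
          ((congrArg (fun v : ℝ × EuclideanSpace ℝ (Fin 1) => covariantSecondDeriv
            (flrwMetric timeInterval f) surfaceModel (hopfLift sineTime b) x v v w) he2).trans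
              (hc2 F⁻¹)))
      -- The `i X` terms, both equal to `k V² F² ⟪i X, w⟫`, cancel; `hid` is what remains.
      have hid := mean_curvature_identity hF0 hV0 (hunit x.1) (hσ2 x.1) (hode x.1) h1
      refine (hgH w).trans (Eq.trans ?_ (congrArg (· / 2) hs.symm))
      field_simp
      field_simp at hid
      linear_combination hid
    -- The time component of `H` is positive.
    · intro h
      have h0 : dTime timeInterval p H = 0 :=
        (congrArg (dTime timeInterval p) h).trans (map_zero _)
      rw [hH1] at h0
      have : 0 < k * V ^ 2 / 2 * (F ^ 2 * V) := by positivity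
      linarith
    -- The squared norm is a multiple of `1 + cos² s - F² V²`.
    · refine (hgH H).trans ?_
      have h5 := hunit x.1
      rw [hH1, hH2]
      simp only [inner_add_right, real_inner_smul_right, hXX, hIX, real_inner_I_smul_I_smul]
      rw [real_inner_comm _ X, hIX]
      linear_combination (-(k * V ^ 2 / 2) ^ 2 * F ^ 2) * h5

end MarginallyTrapped

/-! ### The differential equation of the warping function -/

noncomputable section WarpingFunction

/-- The integrating factor `(2 - t²) ^ (1/4)` of the differential equation of the warping
function. -/
def integratingFactor (t : ℝ) : ℝ := (2 - t ^ 2) ^ (1 / 4 : ℝ)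

theorem two_sub_sq_pos {t : ℝ} (ht : t ∈ Set.Icc (-1.3 : ℝ) 1.3) : 0 < 2 - t ^ 2 := by
  norm_num at ht
  nlinarith [ht.1, ht.2]

theorem integratingFactor_pos {t : ℝ} (ht : t ∈ Set.Icc (-1.3 : ℝ) 1.3) :
    0 < integratingFactor t :=
  Real.rpow_pos_of_pos (two_sub_sq_pos ht) _

theorem integratingFactor_sq {t : ℝ} (ht : t ∈ Set.Icc (-1.3 : ℝ) 1.3) :
    integratingFactor t ^ 2 = √(2 - t ^ 2) := by
  rw [integratingFactor, ← Real.rpow_natCast, ← Real.rpow_mul (two_sub_sq_pos ht).le,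
    Real.sqrt_eq_rpow]
  norm_num

theorem integratingFactor_pow_four {t : ℝ} (ht : t ∈ Set.Icc (-1.3 : ℝ) 1.3) :
    integratingFactor t ^ 4 = 2 - t ^ 2 := by
  rw [show 4 = 2 * 2 from rfl, pow_mul, integratingFactor_sq ht,
    Real.sq_sqrt (two_sub_sq_pos ht).le]

theorem hasDerivAt_integratingFactor {t : ℝ} (ht : t ∈ Set.Icc (-1.3 : ℝ) 1.3) :
    HasDerivAt integratingFactor (-(t / (2 * (2 - t ^ 2))) * integratingFactor t) t := by
  have h0 := two_sub_sq_pos ht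
  have h1 : HasDerivAt (fun t : ℝ => 2 - t ^ 2) (-(2 * t)) t := by
    simpa using ((hasDerivAt_id t).pow 2).const_sub 2
  refine (h1.rpow_const (p := 1 / 4) (Or.inl h0.ne')).congr_deriv ?_
  rw [Real.rpow_sub_one h0.ne', integratingFactor]
  field_simp
  ring

theorem continuous_integratingFactor : Continuous integratingFactor :=
  (continuous_const.sub (continuous_id.pow 2)).rpow_const fun _ => Or.inr (by norm_num)

/-- Variation of constants: multiplied by the integrating factor `μ`, the equation reads `(μ f)' = k
μ³ / 2`, since `μ² = √(2 - t²)`. -/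
theorem exists_isWarpingSolution (k f₀ : ℝ) : ∃ f, IsWarpingSolution k f₀ f := by
  refine ⟨fun t => (integratingFactor 0 * f₀ + ∫ x in (0 : ℝ)..t, k / 2 * integratingFactor x ^ 3) /
    integratingFactor t, ?_, fun t ht => HasDerivAt.hasDerivWithinAt ?_⟩
  · have := integratingFactor_pos (t := 0) (by norm_num)
    simp only [intervalIntegral.integral_same]
    field_simp
    ring
  · have hc : Continuous fun x => k / 2 * integratingFactor x ^ 3 :=
      continuous_const.mul (continuous_integratingFactor.pow 3)
    have h1 := (hc.integral_hasStrictDerivAt 0 t).hasDerivAt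
    have h2 := integratingFactor_pos ht
    have h3 := two_sub_sq_pos ht
    refine ((h1.const_add _).fun_div (hasDerivAt_integratingFactor ht) h2.ne').congr_deriv ?_
    rw [← integratingFactor_sq ht]
    field_simp
    ring

variable {k f₀ : ℝ} {f : ℝ → ℝ}

/-- Mean value inequality for `μ f`, whose derivative `k μ³ / 2` is at most `k` in absolute value.
-/
theorem IsWarpingSolution.abs_sub_le (hf : IsWarpingSolution k f₀ f) (hk : 0 < k) {t : ℝ}
    (ht : t ∈ Set.Icc (-1.3 : ℝ) 1.3) :
    |integratingFactor t * f t - integratingFactor 0 * f₀| ≤ k * 1.3 := by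
  have h0 : (0 : ℝ) ∈ Set.Icc (-1.3 : ℝ) 1.3 := by norm_num
  have h1 : ∀ x ∈ Set.Icc (-1.3 : ℝ) 1.3,
      HasDerivWithinAt (fun t => integratingFactor t * f t) (k / 2 * integratingFactor x ^ 3)
        (Set.Icc (-1.3) 1.3) x := by
    intro x hx
    refine ((hasDerivAt_integratingFactor hx).hasDerivWithinAt.fun_mul (hf.2 x hx)).congr_deriv ?_
    rw [← integratingFactor_sq hx]
    ring
  have h2 : ∀ x ∈ Set.Icc (-1.3 : ℝ) 1.3, ‖k / 2 * integratingFactor x ^ 3‖ ≤ k := by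
    intro x hx
    have h3 := integratingFactor_pos hx
    have h4 := integratingFactor_pow_four hx
    -- Otherwise `μ > 1`, whence `μ⁴ > μ³ > 2`, against `μ⁴ = 2 - x²`.
    have h5 : integratingFactor x ^ 3 ≤ 2 := by
      by_contra! h
      have h6 : 1 < integratingFactor x := by
        by_contra! h7
        have := pow_le_one₀ (n := 3) h3.le h7
        linarith
      nlinarith [sq_nonneg x]
    rw [Real.norm_of_nonneg (by positivity)]
    nlinarith
  have h3 := (convex_Icc (-1.3 : ℝ) 1.3).norm_image_sub_le_of_norm_hasDerivWithin_le h1 h2 h0 ht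
  rw [hf.1, Real.norm_eq_abs, Real.norm_eq_abs, sub_zero] at h3
  have h4 : |t| ≤ 1.3 := abs_le.2 ht
  nlinarith

theorem IsWarpingSolution.le_mul (hf : IsWarpingSolution k f₀ f) (hk : 0 < k)
    (h₀ : 10 * k ≤ f₀) {t : ℝ} (ht : t ∈ Set.Icc (-1.3 : ℝ) 1.3) :
    8 * k ≤ integratingFactor t * f t := by
  have h0 : (0 : ℝ) ∈ Set.Icc (-1.3 : ℝ) 1.3 := by norm_num
  have h1 := (abs_le.1 (hf.abs_sub_le hk ht)).1
  -- Hence `μ f ≥ 10 k - 1.3 k`, which exceeds `8 k`.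
  have h2 : 1 ≤ integratingFactor 0 := by
    by_contra! h
    have h3 := pow_le_one₀ (n := 4) (integratingFactor_pos h0).le h.le
    rw [integratingFactor_pow_four h0] at h3
    norm_num at h3
  nlinarith

theorem IsWarpingSolution.pos (hf : IsWarpingSolution k f₀ f) (hk : 0 < k)
    (h₀ : 10 * k ≤ f₀) {t : ℝ} (ht : t ∈ Set.Icc (-1.3 : ℝ) 1.3) : 0 < f t := by
  have h1 := hf.le_mul hk h₀ ht
  exact pos_of_mul_pos_right (by linarith) (integratingFactor_pos ht).le

theorem IsWarpingSolution.hasDerivAt (hf : IsWarpingSolution k f₀ f) {t : ℝ}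
    (ht : t ∈ Set.Ioo (-1.3 : ℝ) 1.3) :
    HasDerivAt f (t / (2 * (2 - t ^ 2)) * f t + √(2 - t ^ 2) / 2 * k) t :=
  (hf.2 t (Set.Ioo_subset_Icc_self ht)).hasDerivAt (Icc_mem_nhds ht.1 ht.2)

/-- Bootstrapping: the equation expresses `f'` through `f` and smooth coefficients, so `C^n` implies
`C^(n+1)`. -/
theorem IsWarpingSolution.contDiffOn (hf : IsWarpingSolution k f₀ f) :
    ContDiffOn ℝ ∞ f (Set.Ioo (-1.3 : ℝ) 1.3) := by
  rw [contDiffOn_infty]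
  have h0 : ∀ t ∈ Set.Ioo (-1.3 : ℝ) 1.3, 2 - t ^ 2 ≠ 0 := fun t ht =>
    (two_sub_sq_pos (Set.Ioo_subset_Icc_self ht)).ne'
  intro n
  induction n with
  | zero => exact contDiffOn_zero.2 fun t ht => (hf.hasDerivAt ht).continuousAt.continuousWithinAt
  | succ n ih =>
    rw [Nat.cast_succ, contDiffOn_succ_iff_deriv_of_isOpen isOpen_Ioo]
    refine ⟨fun t ht => (hf.hasDerivAt ht).differentiableAt.differentiableWithinAt, by simp, ?_⟩
    refine ContDiffOn.congr ?_ fun t ht => (hf.hasDerivAt ht).deriv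
    have h1 : ContDiffOn ℝ n (fun t : ℝ => 2 - t ^ 2) (Set.Ioo (-1.3 : ℝ) 1.3) :=
      contDiffOn_const.sub (contDiffOn_id.pow 2)
    exact ((contDiffOn_id.div (contDiffOn_const.mul h1)
      fun t ht => mul_ne_zero two_ne_zero (h0 t ht)).mul ih).add
      (((h1.sqrt h0).div_const 2).mul contDiffOn_const)

theorem IsWarpingSolution.deriv_zero_pos (hf : IsWarpingSolution k f₀ f) (hk : 0 < k) :
    0 < deriv f 0 := by
  rw [(hf.hasDerivAt (t := 0) (by norm_num)).deriv]
  simp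
  positivity

/-- At `t = -0.9` one has `2 - t² = 1.19`, and `f ≥ 8 k / 1.19 > 6 k`. The negative term of `f'` is
then below `-2 k`, while the other is at most `0.55 k`. -/
theorem IsWarpingSolution.deriv_neg (hf : IsWarpingSolution k f₀ f) (hk : 0 < k)
    (h₀ : 10 * k ≤ f₀) : deriv f (-0.9) < 0 := by
  have h0 : (-0.9 : ℝ) ∈ Set.Icc (-1.3 : ℝ) 1.3 := by norm_num
  rw [(hf.hasDerivAt (t := -0.9) (by norm_num)).deriv]
  have h1 := hf.le_mul hk h₀ h0
  -- Here `μ⁴ = 1.19`, which is less than `1.19⁴`.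
  have h2 : integratingFactor (-0.9) ≤ 1.19 := by
    by_contra! h
    have h3 := pow_lt_pow_left₀ h (by norm_num) (n := 4) (by norm_num)
    rw [integratingFactor_pow_four h0] at h3
    norm_num at h3
  have h3 := hf.pos hk h₀ h0
  have h4 : √(2 - (-0.9) ^ 2) ≤ 1.1 := by
    rw [Real.sqrt_le_left (by norm_num)]
    norm_num
  norm_num at *
  nlinarith

/-- The function `σ` with `f(sin s)² σ'(s)² = 1 + cos² s`. -/
theorem IsWarpingSolution.exists_arclength (hf : IsWarpingSolution k f₀ f) (hk : 0 < k)
    (h₀ : 10 * k ≤ f₀) : ∃ σ : ℝ → ℝ, ContDiff ℝ ∞ σ ∧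
      ∀ s, deriv σ s = √(1 + Real.cos s ^ 2) / f (Real.sin s) := by
  have hmem : ∀ s, Real.sin s ∈ Set.Ioo (-1.3 : ℝ) 1.3 := fun s => (sineTime s).2
  have h1 : ContDiff ℝ ∞ fun s => √(1 + Real.cos s ^ 2) / f (Real.sin s) :=
    ((contDiff_const.add (Real.contDiff_cos.pow 2)).sqrt fun s => by positivity).div
      (hf.contDiffOn.comp_contDiff Real.contDiff_sin hmem)
      fun s => (hf.pos hk h₀ (Set.Ioo_subset_Icc_self (hmem s))).ne'
  have h2 : ∀ s, HasDerivAt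
      (fun s => ∫ x in (0 : ℝ)..s, √(1 + Real.cos x ^ 2) / f (Real.sin x))
      (√(1 + Real.cos s ^ 2) / f (Real.sin s)) s := fun s =>
    (h1.continuous.integral_hasStrictDerivAt 0 s).hasDerivAt
  refine ⟨_, contDiff_infty_iff_deriv.2 ⟨fun s => (h2 s).differentiableAt, ?_⟩,
    fun s => (h2 s).deriv⟩
  rwa [funext fun s => (h2 s).deriv]

end WarpingFunction

/-! ### Explicit circles in `S²(1/2)` and their horizontal lifts -/

noncomputable section Curves

/-- The map `u ↦ e^{iνu}`. -/
def expCurve (ν u : ℝ) : ℂ := Complex.exp (ν * u * Complex.I)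

theorem hasDerivAt_expCurve (ν u : ℝ) :
    HasDerivAt (expCurve ν) (ν * Complex.I * expCurve ν u) u := by
  have h1 : HasDerivAt (fun u : ℝ => (ν * u * Complex.I : ℂ)) (ν * Complex.I) u := by
    simpa using ((Complex.ofRealCLM.hasDerivAt (x := u)).const_mul (ν : ℂ)).mul_const Complex.I
  exact h1.cexp.congr_deriv (mul_comm _ _)

theorem contDiff_expCurve (ν : ℝ) : ContDiff ℝ ∞ (expCurve ν) :=
  ((contDiff_const.mul Complex.ofRealCLM.contDiff).mul contDiff_const).cexp

theorem norm_expCurve (ν u : ℝ) : ‖expCurve ν u‖ = 1 := by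
  rw [expCurve, ← Complex.ofReal_mul, Complex.norm_exp_ofReal_mul_I]

theorem re_sq_add_im_sq_expCurve (ν u : ℝ) :
    (expCurve ν u).re ^ 2 + (expCurve ν u).im ^ 2 = 1 := by
  have h := Complex.normSq_eq_norm_sq (expCurve ν u)
  rw [norm_expCurve, Complex.normSq_apply] at h
  linarith

theorem expCurve_mul_conj (ν ν' u : ℝ) :
    expCurve ν u * (starRingEnd ℂ) (expCurve ν' u) = expCurve (ν - ν') u := by
  rw [expCurve, expCurve, expCurve, ← Complex.exp_conj, ← Complex.exp_add]
  congr 1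
  simp
  ring

/-- The curve `u ↦ (a e^{ipu}, d e^{iqu})` in `ℂ²`. -/
def torusCurve (p q : ℝ) (a d : ℂ) (u : ℝ) : C2 :=
  WithLp.toLp 2 ![a * expCurve p u, d * expCurve q u]

theorem hasDerivAt_torusCurve (p q : ℝ) (a d : ℂ) (u : ℝ) :
    HasDerivAt (torusCurve p q a d)
      (torusCurve p q (a * (p * Complex.I)) (d * (q * Complex.I)) u) u := by
  have h : HasDerivAt (fun u => ![a * expCurve p u, d * expCurve q u])
      ![a * (p * Complex.I) * expCurve p u, d * (q * Complex.I) * expCurve q u] u := by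
    rw [hasDerivAt_pi]
    intro i
    fin_cases i
    · exact ((hasDerivAt_expCurve p u).const_mul a).congr_deriv (mul_assoc _ _ _).symm
    · exact ((hasDerivAt_expCurve q u).const_mul d).congr_deriv (mul_assoc _ _ _).symm
  exact (PiLp.continuousLinearEquiv 2 ℝ (fun _ : Fin 2 => ℂ)).symm.toContinuousLinearMap.hasFDerivAt
    |>.comp_hasDerivAt u h

theorem contDiff_torusCurve (p q : ℝ) (a d : ℂ) : ContDiff ℝ ∞ (torusCurve p q a d) := by
  refine (PiLp.continuousLinearEquiv 2 ℝ (fun _ : Fin 2 => ℂ)).symm.contDiff.comp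
    (contDiff_pi.2 fun i => ?_)
  fin_cases i
  · exact contDiff_const.mul (contDiff_expCurve p)
  · exact contDiff_const.mul (contDiff_expCurve q)

theorem inner_torusCurve (p q : ℝ) (a d a' d' : ℂ) (u : ℝ) :
    ⟪torusCurve p q a d u, torusCurve p q a' d' u⟫_ℝ =
      ((starRingEnd ℂ) a * a' + (starRingEnd ℂ) d * d').re := by
  have h1 := re_sq_add_im_sq_expCurve p u
  have h2 := re_sq_add_im_sq_expCurve q u
  simp only [PiLp.inner_apply, torusCurve, Fin.sum_univ_two, Complex.inner]
  simp
  linear_combination (a.re * a'.re + a.im * a'.im) * h1 + (d.re * d'.re + d.im * d'.im) * h2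

theorem smul_torusCurve (p q : ℝ) (a d z : ℂ) (u : ℝ) :
    z • torusCurve p q a d u = torusCurve p q (z * a) (z * d) u := by
  ext i
  fin_cases i <;> simp [torusCurve, mul_assoc]

theorem add_torusCurve (p q : ℝ) (a d a' d' : ℂ) (u : ℝ) :
    torusCurve p q a d u + torusCurve p q a' d' u = torusCurve p q (a + a') (d + d') u := by
  ext i
  fin_cases i <;> simp [torusCurve, add_mul]

/-- If `a² + d² = 1`, then `u ↦ (a e^{i(d/a)u}, d e^{-i(a/d)u})` is a unit speed horizontal curve of
the unit sphere, with constant curvature `d / a - a / d`. -/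
theorem isHorizontalCircle_torusCurve {k a d : ℝ} (ha : 0 < a) (hd : 0 < d)
    (had : a ^ 2 + d ^ 2 = 1) (hk : d / a - a / d = k) :
    IsHorizontalCircle k (torusCurve (d / a) (-(a / d)) a d) := by
  have h1 : deriv (torusCurve (d / a) (-(a / d)) a d) =
      torusCurve (d / a) (-(a / d)) (d * Complex.I) (-a * Complex.I) := by
    ext1 u
    rw [(hasDerivAt_torusCurve _ _ _ _ u).deriv]
    have : (a : ℂ) ≠ 0 := by exact_mod_cast ha.ne'
    have : (d : ℂ) ≠ 0 := by exact_mod_cast hd.ne'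
    congr 1
    · push_cast
      field_simp
    · push_cast
      field_simp
  refine ⟨contDiff_torusCurve _ _ _ _, fun u => ?_, fun u => ?_, fun u => ?_, fun u => ?_⟩
  · rw [← sq_eq_sq₀ (norm_nonneg _) zero_le_one, ← real_inner_self_eq_norm_sq, inner_torusCurve]
    simp
    linarith
  · rw [h1, ← sq_eq_sq₀ (norm_nonneg _) zero_le_one, ← real_inner_self_eq_norm_sq,
      inner_torusCurve]
    simp
    linarith
  · rw [h1, smul_torusCurve, inner_torusCurve]
    simp
    ring
  · rw [h1, (hasDerivAt_torusCurve _ _ _ _ u).deriv, smul_torusCurve, ← neg_one_smul ℂ (torusCurve _ _ _ _ u),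
      smul_torusCurve, ← Complex.coe_smul k, smul_torusCurve, add_torusCurve, ← hk]
    have : (a : ℂ) ≠ 0 := by exact_mod_cast ha.ne'
    have : (d : ℂ) ≠ 0 := by exact_mod_cast hd.ne'
    congr 1
    · push_cast
      field_simp
      ring_nf
      simp
    · push_cast
      field_simp
      ring_nf
      simp

/-- The circle `u ↦ (r e^{iνu}, h)` in `ℂ × ℝ`. -/
def parallelCircle (ν r h u : ℝ) : CR := WithLp.toLp 2 (r * expCurve ν u, h)

theorem hasDerivAt_toLp_expCurve (ν : ℝ) (z : ℂ) (h u : ℝ) :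
    HasDerivAt (fun u => (WithLp.toLp 2 (z * expCurve ν u, h) : CR))
      (WithLp.toLp 2 (z * (ν * Complex.I) * expCurve ν u, 0)) u := by
  have h1 : HasDerivAt (fun u => (z * expCurve ν u, h))
      (z * (ν * Complex.I) * expCurve ν u, 0) u :=
    (((hasDerivAt_expCurve ν u).const_mul z).congr_deriv (mul_assoc _ _ _).symm).prodMk
      (hasDerivAt_const u h)
  exact (WithLp.prodContinuousLinearEquiv 2 ℝ ℂ ℝ).symm.toContinuousLinearMap.hasFDerivAt
    |>.comp_hasDerivAt u h1

theorem contDiff_toLp_expCurve (ν : ℝ) (z : ℂ) (h : ℝ) :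
    ContDiff ℝ ∞ (fun u => (WithLp.toLp 2 (z * expCurve ν u, h) : CR)) :=
  (WithLp.prodContinuousLinearEquiv 2 ℝ ℂ ℝ).symm.contDiff.comp
    ((contDiff_const.mul (contDiff_expCurve ν)).prodMk contDiff_const)

theorem inner_toLp_expCurve (ν : ℝ) (z z' : ℂ) (h h' u : ℝ) :
    ⟪(WithLp.toLp 2 (z * expCurve ν u, h) : CR), WithLp.toLp 2 (z' * expCurve ν u, h')⟫_ℝ =
      ((starRingEnd ℂ) z * z').re + h * h' := by
  have h1 := re_sq_add_im_sq_expCurve ν u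
  rw [WithLp.prod_inner_apply]
  simp [Complex.inner]
  linear_combination (z.re * z'.re + z.im * z'.im) * h1

/-- A parallel of radius `r` at height `h` has unit speed when `r ν = 1`, and its curvature with
respect to the normal `(2 h e^{iνu}, -2 r)` is `-2 h / r`. -/
theorem isCircleOfCurvature_parallelCircle {k ν r h : ℝ} (hν : r * ν = 1)
    (hk : h = -(k * r / 2)) (hr : r ^ 2 + h ^ 2 = 1 / 4) :
    IsCircleOfCurvature k (parallelCircle ν r h) := by
  have h0 : r ≠ 0 := by
    rintro rfl
    simp at hν
  have hν' : ν = r⁻¹ := eq_inv_of_mul_eq_one_right hν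
  have hd1 : deriv (parallelCircle ν r h) =
      fun u => (WithLp.toLp 2 (r * (ν * Complex.I) * expCurve ν u, 0) : CR) :=
    funext fun u => (hasDerivAt_toLp_expCurve ν r h u).deriv
  have hd2 : ∀ u, deriv (deriv (parallelCircle ν r h)) u =
      WithLp.toLp 2 (r * (ν * Complex.I) * (ν * Complex.I) * expCurve ν u, 0) := fun u => by
    rw [hd1, (hasDerivAt_toLp_expCurve ν _ 0 u).deriv]
  refine ⟨contDiff_toLp_expCurve ν r h, fun u => ?_, fun u => ?_,
    fun u => WithLp.toLp 2 (((2 * h : ℝ) : ℂ) * expCurve ν u, -2 * r),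
    (contDiff_toLp_expCurve ν _ _).continuous, fun u => ⟨?_, ?_, ?_, ?_⟩⟩
  · rw [mem_sphere_zero_iff_norm, ← sq_eq_sq₀ (norm_nonneg _) (by norm_num),
      ← real_inner_self_eq_norm_sq, parallelCircle, inner_toLp_expCurve]
    simp
    linarith
  · rw [hd1, ← sq_eq_sq₀ (norm_nonneg _) zero_le_one, ← real_inner_self_eq_norm_sq,
      inner_toLp_expCurve]
    simp
    linear_combination (r * ν + 1) * hν
  · rw [← sq_eq_sq₀ (norm_nonneg _) zero_le_one, ← real_inner_self_eq_norm_sq,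
      inner_toLp_expCurve]
    simp
    linarith
  · rw [parallelCircle, inner_toLp_expCurve]
    simp
    ring
  · rw [hd1, inner_toLp_expCurve]
    simp
  · refine Submodule.eq_starProjection_of_mem_orthogonal
      (K := (ℝ ∙ parallelCircle ν r h u)ᗮ) ?_ ?_
    · refine Submodule.smul_mem _ _ (Submodule.mem_orthogonal_singleton_iff_inner_left.2 ?_)
      rw [parallelCircle, inner_toLp_expCurve]
      simp
      ring
    · rw [Submodule.orthogonal_orthogonal (ℝ ∙ parallelCircle ν r h u), Submodule.mem_span_singleton]
      -- A unit speed curve on a sphere of radius `1/2` has acceleration with radial part `-4 c`.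
      refine ⟨-4, ?_⟩
      rw [hd2, parallelCircle]
      have h2 : ν = 4 * r + k ^ 2 * r := by
        apply mul_left_cancel₀ h0
        rw [hν, hk] at *
        linear_combination -4 * hr
      refine congrArg (WithLp.toLp 2) (Prod.ext ?_ ?_)
      · change (-4 : ℝ) • ((r : ℂ) * expCurve ν u) = r * (ν * Complex.I) * (ν * Complex.I) *
          expCurve ν u - k • (((2 * h : ℝ) : ℂ) * expCurve ν u)
        have h3 : (r * ν : ℂ) = 1 := by exact_mod_cast hν
        have h4 : (ν : ℂ) = 4 * r + k ^ 2 * r := by exact_mod_cast h2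
        rw [hk, Complex.real_smul, Complex.real_smul]
        push_cast
        linear_combination (-(r * ν ^ 2 * expCurve ν u) : ℂ) * Complex.I_sq +
          (ν * expCurve ν u) * h3 + expCurve ν u * h4
      · change (-4 : ℝ) * h = 0 - k * (-2 * r)
        rw [hk]
        ring

/-- Conjugating the second coordinate subtracts the frequencies, and the height depends only on the
two moduli. -/
theorem hopfMap_torusCurve {p q a d ν r h : ℝ} {x : S3} {u : ℝ}
    (hx : (x : C2) = torusCurve p q a d u) (hν : p - q = ν) (hr : a * d = r)
    (hh : (a ^ 2 - d ^ 2) / 2 = h) : hopfMap x = parallelCircle ν r h u := by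
  rw [hopfMap, parallelCircle, hx, ← hν, ← expCurve_mul_conj, ← hr, ← hh]
  simp [torusCurve, norm_expCurve]
  constructor <;> ring

end Curves

/-! ### The main theorem -/

theorem mainTheorem6 (k : ℝ) (hk : 0 < k) :
    ∃ F₀ : ℝ, 0 < F₀ ∧ ∀ f₀ : ℝ, F₀ ≤ f₀ →
      (∃ f : ℝ → ℝ, IsWarpingSolution k f₀ f) ∧
      ∀ f : ℝ → ℝ, IsWarpingSolution k f₀ f →
        IsWarpingFunction timeInterval f ∧
        (∀ t ∈ Set.Icc (-1.3 : ℝ) 1.3, 0 < f t) ∧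
        (∃ t ∈ Set.Ioo (-1 : ℝ) 1, deriv f t < 0) ∧
        (∃ t ∈ Set.Ioo (-1 : ℝ) 1, 0 < deriv f t) ∧
        ∃ (c : ℝ → CR) (σ : ℝ → ℝ) (b : ℝ → S3),
          IsCircleOfCurvature k c ∧
          ContDiff ℝ ∞ σ ∧ (∀ s, 0 < deriv σ s) ∧
          IsUnitSpacelikeCurve f Real.sin (fun s => c (σ s)) ∧
          IsHorizontalLift (fun s => c (σ s)) b ∧
          IsMarginallyTrapped (flrwMetric timeInterval f) surfaceModel (hopfLift sineTime b) ∧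
          (∃ x : ℝ × Circle, 0 < deriv f (hopfLift sineTime b x).1) ∧
          (∃ x : ℝ × Circle, deriv f (hopfLift sineTime b x).1 < 0) := by
  refine ⟨10 * k, by positivity, fun f₀ h₀ => ⟨exists_isWarpingSolution k f₀, fun f hf => ?_⟩⟩
  have hmem : ∀ s, Real.sin s ∈ Set.Ioo (-1.3 : ℝ) 1.3 := fun s => (sineTime s).2
  have hpos : ∀ s, 0 < f (Real.sin s) := fun s =>
    hf.pos hk h₀ (Set.Ioo_subset_Icc_self (hmem s))
  obtain ⟨σ, hσ, hσd⟩ := hf.exists_arclength hk h₀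
  have hσ0 : ∀ s, 0 < deriv σ s := fun s => by
    rw [hσd]
    exact div_pos (Real.sqrt_pos.2 (by positivity)) (hpos s)
  have hFV : ∀ s, f (Real.sin s) * deriv σ s = √(1 + Real.cos s ^ 2) := fun s => by
    have := (hpos s).ne'
    rw [hσd]
    field_simp
  have hunit : ∀ s, f (Real.sin s) ^ 2 * deriv σ s ^ 2 = 1 + Real.cos s ^ 2 := fun s => by
    rw [← mul_pow, hFV, Real.sq_sqrt (by positivity)]
  -- With `h = -k r / 2`, the condition `r² + h² = 1/4` forces `r = 1 / √(4 + k²)`.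
  set ν := √(4 + k ^ 2) with hν
  have hν2 : ν ^ 2 = 4 + k ^ 2 := Real.sq_sqrt (by positivity)
  have hν0 : 0 < ν := Real.sqrt_pos.2 (by positivity)
  have hkν : k < ν := by
    refine lt_of_pow_lt_pow_left₀ 2 hν0.le ?_
    linarith
  set r := ν⁻¹ with hr
  have hrν : r * ν = 1 := inv_mul_cancel₀ hν0.ne'
  have hr0 : 0 < r := inv_pos.2 hν0
  set h := -(k * r / 2) with hh
  have hrh : r ^ 2 + h ^ 2 = 1 / 4 := by
    rw [hh]
    linear_combination (-r ^ 2 / 4) * hν2 + (r * ν + 1) / 4 * hrν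
  have hkr : k * r < 1 := by
    rw [← hrν, mul_comm]
    exact mul_lt_mul_of_pos_left hkν hr0
  -- The moduli of the lift solve `a² + d² = 1` and `(a² - d²) / 2 = h`; then `a d = r` follows from
  -- `r² + h² = 1/4`.
  obtain ⟨a, ha0, ha2⟩ : ∃ a, 0 < a ∧ a ^ 2 = 1 / 2 + h :=
    ⟨√(1 / 2 + h), Real.sqrt_pos.2 (by linarith), Real.sq_sqrt (by linarith)⟩
  obtain ⟨d, hd0, hd2⟩ : ∃ d, 0 < d ∧ d ^ 2 = 1 / 2 - h :=
    ⟨√(1 / 2 - h), Real.sqrt_pos.2 (by nlinarith), Real.sq_sqrt (by nlinarith)⟩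
  have hadr : a * d = r := by
    refine (sq_eq_sq₀ (by positivity) hr0.le).1 ?_
    rw [mul_pow, ha2, hd2]
    linarith
  have hsum : a ^ 2 + d ^ 2 = 1 := by linarith
  have hB : IsHorizontalCircle k (torusCurve (d / a) (-(a / d)) a d) := by
    refine isHorizontalCircle_torusCurve ha0 hd0 hsum ?_
    field_simp
    rw [hd2, ha2, mul_comm d a, hadr, hh]
    ring
  have hpq : d / a - -(a / d) = ν := by
    rw [eq_inv_of_mul_eq_one_right hrν, ← hadr]
    field_simp
    linarith
  have hc : IsCircleOfCurvature k (parallelCircle ν r h) :=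
    isCircleOfCurvature_parallelCircle hrν hh hrh
  set B := torusCurve (d / a) (-(a / d)) a d with hBdef
  let b : ℝ → S3 := fun s => ⟨B (σ s), mem_sphere_zero_iff_norm.2 (hB.norm_eq_one _)⟩
  have hb : ∀ s, (b s : C2) = B (σ s) := fun s => rfl
  refine ⟨⟨hf.contDiffOn, fun t ht => hf.pos hk h₀ (Set.Ioo_subset_Icc_self ht)⟩,
    fun t ht => hf.pos hk h₀ ht, ⟨-0.9, by norm_num, hf.deriv_neg hk h₀⟩,
    ⟨0, by norm_num, hf.deriv_zero_pos hk⟩, parallelCircle ν r h, σ, b, hc, hσ, hσ0,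
    fun s => ?_, ⟨hB.contDiff.comp hσ, fun s => ?_, fun s => ?_⟩, ?_, ⟨(0, 1), ?_⟩,
    ⟨(Real.arcsin (-0.9), 1), ?_⟩⟩
  · have h1 : HasDerivAt (fun s => parallelCircle ν r h (σ s))
        (deriv σ s • deriv (parallelCircle ν r h) (σ s)) s :=
      (hc.1.differentiable (by simp) _).hasDerivAt.scomp s
        (hσ.differentiable (by simp) s).hasDerivAt
    rw [h1.deriv, norm_smul, hc.2.2.1, mul_one, Real.norm_eq_abs, sq_abs, hunit, Real.deriv_sin]
    ring
  · exact hopfMap_torusCurve (hb s) hpq hadr (by linarith)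
  · simp only [hb]
    rw [deriv_comp_of_contDiff hB.contDiff hσ, real_inner_smul_left, hB.inner_I_smul, mul_zero]
  · refine isMarginallyTrapped_hopfLift hk hB hσ hb hσ0
      (fun s => (hf.hasDerivAt (hmem s)).differentiableAt) hpos hunit fun s => ?_
    -- This relation turns `√(2 - t²)` into `F V`, and the equation of `f` into the hypothesis
    -- `hode`.
    have h1 : 2 - Real.sin s ^ 2 = 1 + Real.cos s ^ 2 := by
      rw [Real.sin_sq]
      ring
    have h2 : 0 < 1 + Real.cos s ^ 2 := by positivity
    rw [(hf.hasDerivAt (hmem s)).deriv, h1, ← hFV]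
    field_simp
  · change 0 < deriv f (Real.sin 0)
    rw [Real.sin_zero]
    exact hf.deriv_zero_pos hk
  · change deriv f (Real.sin (Real.arcsin (-0.9))) < 0
    rw [Real.sin_arcsin (by norm_num) (by norm_num)]
    exact hf.deriv_neg hk h₀
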